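/- **Setting.** Let $n\le m$ be positive integers. A stream is a finite sequence $S=((d_1,\delta_1),\dots,(d_N,\delta_N))$ with $d_i\in[n]$ and $\delta_i\in\mathbb Z$. For $0\le k\le N$ let $f^{(k)}_d=\sum_{j\le k,\ d_j=d}\delta_j$, let $f=f^{(N)}$ be the frequency vector, and let $M=M(S)=\max\{n,|f^{(k)}_d| : d\in[n],\ 0\le k\le N\}$. Let $\mathcal T$ be the set of all (turnstile) streams with $\sum_d|f_d|\le m$, and let $\mathcal I\subseteq\mathcal T$ be the set of the insertion-only ones, i.e. those with $\delta_i=1$ for all $i$. For $p<0$ put $F_p=\sum_{d:\,f_d\ne0}|f_d|^p$. A randomized streaming algorithm reads the stream once. Its memory is a bit string, which is initialized at random; at each update it is replaced by a new, possibly random, bit string that depends only on the update and on the old contents; after the last update the (possibly random) real output is produced from the memory. The algorithm may depend on $n,m,\varepsilon,p$. The number of bits it uses on a stream is the largest length of the memory while the stream is read, with worst-case randomness; the number of bits it uses is the maximum of this over all valid streams. It is a $(1\pm\varepsilon)$-approximation algorithm for $F_p$ on turnstile (insertion-only) streams if for every $S\in\mathcal T$ ($S\in\mathcal I$), with probability at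 least $2/3$, its output lies in $[(1-\varepsilon)F_p,(1+\varepsilon)F_p]$. **Claim.** There are absolute constants $c,C>0$ such that the following hold for all $p<0$, $0<\varepsilon\le 1/2$ and $1\le n\le m$. 1. Every $(1\pm\varepsilon)$-approximation algorithm for $F_p$ on insertion-only streams, and every one on turnstile streams, uses at least $$c\cdot\min\left\{n,\ \varepsilon^{-\frac{1}{1-p}}\,m^{\frac{-p}{1-p}}\right\}$$ bits. For turnstile algorithms this many bits are needed already on the streams in $\mathcal T$ with $M(S)\le m$. 2. If $n\ge2$, there is a $(1\pm\varepsilon)$-approximation algorithm for $F_p$ on turnstile streams that on every $S\in\mathcal T$ uses at most $$C\,\varepsilon^{-\frac{2-p}{1-p}}\,m^{\frac{-p}{1-p}}\,\log^2 n\,\log M(S)$$ bits. 3. If $n\ge2$, there is a $(1\pm\varepsilon)$-approximation algorithm for $F_p$ on insertion-only streams that on every $S\in\mathcal I$ uses at most $$C\,\varepsilon^{-\frac{2-p}{1-p}}\,m^{\frac{-p}{1-p}}\,\log M(S)$$ bits. -/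

import Mathlib

open scoped ENNReal

namespace Streaming

/-- A stream over the items `Fin n`: a finite sequence of updates `(d, δ)` with `δ ∈ ℤ`. -/
abbrev UpdateStream (n : ℕ) : Type := List (Fin n × ℤ)

/-- The frequency of the item `d` in the stream `S`: the sum of all updates to `d`. -/
def freq {n : ℕ} (S : UpdateStream n) (d : Fin n) : ℤ :=
  ((S.filter (fun u => u.1 = d)).map Prod.snd).sum

/-- The `L¹` length of the frequency vector. -/
def l1Length {n : ℕ} (S : UpdateStream n) : ℕ :=
  ∑ d : Fin n, (freq S d).natAbs

/-- `M = max {n, |f_d^(k)| : d ∈ [n], 0 ≤ k ≤ N}`, where `f^(k)` is the frequency vector after the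
first `k` of the `N` updates. -/
def maxMagnitude {n : ℕ} (S : UpdateStream n) : ℕ :=
  max n ((Finset.range (S.length + 1)).sup fun k =>
    Finset.univ.sup fun d : Fin n => (freq (S.take k) d).natAbs)

/-- The turnstile streams whose final frequency vector has `L¹` length at most `m`. -/
def turnstile (n m : ℕ) : Set (UpdateStream n) :=
  {S | l1Length S ≤ m}

/-- The insertion-only streams (every update is `+1`) whose final frequency vector has `L¹` length
at most `m`. -/
def insertionOnly (n m : ℕ) : Set (UpdateStream n) :=
  {S | (∀ u ∈ S, u.2 = 1) ∧ l1Length S ≤ m}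

/-- The frequency moment `F_p`: the sum of `|f_d|^p` over the items with nonzero frequency. -/
noncomputable def freqMoment {n : ℕ} (p : ℝ) (S : UpdateStream n) : ℝ :=
  ∑ d : Fin n with freq S d ≠ 0, |(freq S d : ℝ)| ^ p

/-- A randomized one-pass streaming algorithm. Its memory holds a bit string. It is initialized at
random, is rewritten (with fresh randomness) on each update as a function of the update and of the
current memory contents only, and after the last update the output is produced from the memory.
Random bits that are to be reused later have to be kept in the memory. -/
structure Algorithm (n : ℕ) where
  /-- the distribution of the initial memory contents -/
  init : PMF (List Bool)
  /-- the distribution of the new memory contents, given the update and the old contents -/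
  step : Fin n × ℤ → List Bool → PMF (List Bool)
  /-- the distribution of the output, given the final memory contents -/
  output : List Bool → PMF ℝ

namespace Algorithm

variable {n : ℕ}

/-- The distribution of the memory contents after the algorithm has read `S`. -/
noncomputable def run (A : Algorithm n) (S : UpdateStream n) : PMF (List Bool) :=
  S.foldl (fun μ u => μ.bind (A.step u)) A.init

/-- The distribution of the output of the algorithm on the stream `S`. -/
noncomputable def result (A : Algorithm n) (S : UpdateStream n) : PMF ℝ :=
  (A.run S).bind A.output

/-- On the stream `S` the algorithm never stores more than `b` bits, at any time while it reads
`S` and for any outcome of its randomness. -/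
def StorageAtMost (A : Algorithm n) (S : UpdateStream n) (b : ℝ) : Prop :=
  ∀ k ≤ S.length, ∀ w ∈ (A.run (S.take k)).support, (w.length : ℝ) ≤ b

/-- `A` is a `(1 ± ε)`-approximation algorithm for `F_p` on the streams in `X`: on each of them its
output lies in `[(1 - ε) F_p, (1 + ε) F_p]` with probability at least `2/3`. -/
def Approximates (A : Algorithm n) (X : Set (UpdateStream n)) (ε p : ℝ) : Prop :=
  ∀ S ∈ X, (2 / 3 : ℝ≥0∞) ≤
    (A.result S).toMeasure (Set.Icc ((1 - ε) * freqMoment p S) ((1 + ε) * freqMoment p S))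

end Algorithm

end Streaming

namespace Streaming

/-! ### A counting form of the one-way lower bound for the index problem -/

/-! Lower bound. Reduce from the one-way index problem. Alice encodes k bits by inserting one item
out of each of k pairs, and the memory is her message. Bob, who wants bit i, inserts T copies of
every item of the pairs except the first item of pair i. That item then has frequency 1 or 0
according to the bit, so F_p changes by at least 1, while every other item contributes at most T^p.
Hence F_p is at most about 2kT^p plus 1, and a (1±ε)-approximation reveals the bit once εkT^p < 1/8
(`index_reduction`). With T of order m/k this permits k of order min(n, ε^(-1/(1-p)) m^(-p/(1-p))).
The index problem needs a linear number of bits by a counting argument (`index_lower_bound`). All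
these streams are insertion-only with M ≤ m, so the bound holds in both models.

Upper bounds. Sample the items, not the updates: a pairwise independent hash keeps an item on level
j with probability about 2^(-j). Stop at the first level on which at most s items of the support
survive, and rescale the moment of the surviving part. As p < 0 and frequencies are integers, every
weight |f_d|^p is at most 1, so at sampling rate ρ the variance of the sampled moment is at most
ρF_p, and Chebyshev bounds the failure probability by 1/(ε²ρF_p). With r items in the support the
final rate is about s/r. Hölder gives r^(1-p) ≤ F_p m^(-p) (`card_supp_rpow_le`), so s^(1-p) ≥ 2048
ε^(-2) m^(-p) makes this probability small (`sample_size_suffices`, `card_bad_seeds_le`).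

For insertions the support only grows, so the stopping level never decreases and the sample is kept
explicitly. For turnstile streams each level carries a linear sketch, built from Vandermonde
coefficients, that determines every 16s-sparse vector. Denser levels may decode to nonsense. A level
with more than s but at most 16s survivors, which exists with high probability, separates them from
the trustworthy ones (`outputLevel_sketch`).

The constants do not depend on p because numerical factors are always absorbed into the base of a
power with exponent 1-p ≥ 1. -/

/-- Exponential Markov inequality with base 2: summed over the cube, the exponential of the score
factorizes over the coordinates. `G i β` stands for the probability of answering β to query i. -/
theorem card_heavy_le {k : ℕ} (G : Fin k → Bool → ℝ) (h0 : ∀ i β, 0 ≤ G i β)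
    (h1 : ∀ i, G i false + G i true ≤ 1) :
    ((Finset.univ.filter fun x : Fin k → Bool => 2 / 3 * (k : ℝ) ≤ ∑ i, G i (x i)).card : ℝ) *
      2 ^ (2 / 3 * (k : ℝ)) ≤ 3 ^ k := by
  have key : ∑ x : Fin k → Bool, (2 : ℝ) ^ (∑ i, G i (x i)) ≤ 3 ^ k := by
    calc ∑ x : Fin k → Bool, (2 : ℝ) ^ (∑ i, G i (x i))
        = ∑ x : Fin k → Bool, ∏ i, (2 : ℝ) ^ (G i (x i)) := by
          refine Finset.sum_congr rfl fun x _ => ?_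
          rw [Real.rpow_sum_of_pos two_pos]
      _ = ∏ i, ∑ β : Bool, (2 : ℝ) ^ (G i β) := by
          rw [Finset.prod_univ_sum, Fintype.piFinset_univ]
      _ ≤ ∏ _i : Fin k, (3 : ℝ) := by
          refine Finset.prod_le_prod (fun i _ => Finset.sum_nonneg fun β _ => by positivity) ?_
          intro i _
          -- By convexity 2^t lies below its chord 1+t on [0,1], so the two answers together give at
          -- most 2+1 = 3.
          have hb : ∀ β, (2 : ℝ) ^ (G i β) ≤ 1 + G i β := by
            intro β
            have hle : G i β ≤ 1 := by
              cases β
              · linarith [h1 i, h0 i true]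
              · linarith [h1 i, h0 i false]
            have := rpow_one_add_le_one_add_mul_self (s := 1) (by norm_num) (h0 i β) hle
            norm_num at this
            linarith
          rw [Fintype.sum_bool]
          linarith [hb false, hb true, h1 i]
      _ = 3 ^ k := by simp
  refine le_trans ?_ key
  rw [← nsmul_eq_mul, ← Finset.sum_const]
  refine le_trans (Finset.sum_le_sum (fun x hx => ?_)) (Finset.sum_le_univ_sum_of_nonneg
    (fun x => by positivity))
  exact Real.rpow_le_rpow_of_exponent_le (by norm_num) (Finset.mem_filter.mp hx).2

/-- For each input x, averaging over the message yields one message in `W` whose expected number of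
correct answers is at least 2k/3. The sets of inputs served that well by a fixed message are small
by `card_heavy_le`, and together they cover the cube. -/
theorem index_lower_bound {k : ℕ} (W : Finset (List Bool))
    (D : (Fin k → Bool) → PMF (List Bool)) (hD : ∀ x, (D x).support ⊆ W)
    (g : List Bool → Fin k → Bool → ℝ≥0∞) (hg : ∀ w i, g w i false + g w i true ≤ 1)
    (h : ∀ x i, 2 / 3 ≤ ∑' w, D x w * g w i (x i)) :
    (32 : ℝ) ^ k ≤ 27 ^ k * (W.card : ℝ) ^ 3 := by
  have hgle : ∀ w i β, g w i β ≤ 1 := by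
    intro w i β
    cases β
    · exact le_trans le_self_add (hg w i)
    · exact le_trans le_add_self (hg w i)
  have hgtop : ∀ w i β, g w i β ≠ ∞ := fun w i β => ne_top_of_le_ne_top ENNReal.one_ne_top (hgle w i β)
  have hDtop : ∀ x w, D x w ≠ ∞ := fun x w => (D x).apply_ne_top w
  have hzero : ∀ x, ∀ w ∉ W, D x w = 0 := by
    intro x w hw
    by_contra hne
    exact hw (hD x ((PMF.mem_support_iff _ _).2 hne))
  have hsum1 : ∀ x, ∑ w ∈ W, (D x w).toReal = 1 := by
    intro x
    have h1 : ∑ w ∈ W, D x w = 1 := by rw [← (D x).tsum_coe, tsum_eq_sum (hzero x)]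
    rw [← ENNReal.toReal_sum (fun w _ => hDtop x w), h1, ENNReal.toReal_one]
  have hsumg : ∀ x i, 2 / 3 ≤ ∑ w ∈ W, (D x w).toReal * (g w i (x i)).toReal := by
    intro x i
    have h2 := h x i
    rw [tsum_eq_sum (s := W) (fun w hw => by rw [hzero x w hw, zero_mul])] at h2
    have h3 := ENNReal.toReal_mono (ENNReal.sum_ne_top.2 fun w _ =>
      ENNReal.mul_ne_top (hDtop x w) (hgtop w i _)) h2
    rw [ENNReal.toReal_sum fun w _ => ENNReal.mul_ne_top (hDtop x w) (hgtop w i _)] at h3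
    simpa [ENNReal.toReal_mul] using h3
  have hex : ∀ x : Fin k → Bool, ∃ w ∈ W, 2 / 3 * (k : ℝ) ≤ ∑ i, (g w i (x i)).toReal := by
    intro x
    by_contra hcon
    push Not at hcon
    have hlow : 2 / 3 * (k : ℝ) ≤ ∑ w ∈ W, (D x w).toReal * ∑ i, (g w i (x i)).toReal := by
      calc 2 / 3 * (k : ℝ) = ∑ _i : Fin k, (2 / 3 : ℝ) := by simp; ring
        _ ≤ ∑ i, ∑ w ∈ W, (D x w).toReal * (g w i (x i)).toReal :=
            Finset.sum_le_sum fun i _ => hsumg x i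
        _ = _ := by rw [Finset.sum_comm]; simp_rw [Finset.mul_sum]
    have hup : ∑ w ∈ W, (D x w).toReal * ∑ i, (g w i (x i)).toReal
        < ∑ w ∈ W, (D x w).toReal * (2 / 3 * (k : ℝ)) := by
      refine Finset.sum_lt_sum (fun w hw => mul_le_mul_of_nonneg_left (hcon w hw).le
        ENNReal.toReal_nonneg) ?_
      obtain ⟨w, hw, hpos⟩ : ∃ w ∈ W, 0 < (D x w).toReal := by
        by_contra hno
        push Not at hno
        have := Finset.sum_nonpos hno
        rw [hsum1 x] at this
        linarith
      exact ⟨w, hw, mul_lt_mul_of_pos_left (hcon w hw) hpos⟩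
    rw [← Finset.sum_mul, hsum1 x, one_mul] at hup
    linarith
  have hcard : (2 : ℝ) ^ k * 2 ^ (2 / 3 * (k : ℝ)) ≤ W.card * 3 ^ k := by
    have hsub : (Finset.univ : Finset (Fin k → Bool)) ⊆ W.biUnion fun w =>
        Finset.univ.filter fun x : Fin k → Bool => 2 / 3 * (k : ℝ) ≤ ∑ i, (g w i (x i)).toReal := by
      intro x _
      obtain ⟨w, hw, hx⟩ := hex x
      simp only [Finset.mem_biUnion, Finset.mem_filter, Finset.mem_univ, true_and]
      exact ⟨w, hw, hx⟩
    have h1 := (Finset.card_le_card hsub).trans Finset.card_biUnion_le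
    have hheavy : ∀ w, (((fun w => (Finset.univ.filter fun x : Fin k → Bool =>
        2 / 3 * (k : ℝ) ≤ ∑ i, (g w i (x i)).toReal).card) w : ℕ) : ℝ) * 2 ^ (2 / 3 * (k : ℝ)) ≤ 3 ^ k := by
      intro w
      refine card_heavy_le (fun i β => (g w i β).toReal) (fun _ _ => ENNReal.toReal_nonneg) ?_
      intro i
      rw [← ENNReal.toReal_add (hgtop _ _ _) (hgtop _ _ _)]
      simpa using ENNReal.toReal_mono ENNReal.one_ne_top (hg w i)
    rw [Finset.card_univ, Fintype.card_fun, Fintype.card_bool, Fintype.card_fin] at h1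
    change 2 ^ k ≤ ∑ w ∈ W, (fun w => (Finset.univ.filter fun x : Fin k → Bool =>
        2 / 3 * (k : ℝ) ≤ ∑ i, (g w i (x i)).toReal).card) w at h1
    generalize (fun w => (Finset.univ.filter fun x : Fin k → Bool =>
        2 / 3 * (k : ℝ) ≤ ∑ i, (g w i (x i)).toReal).card) = N at h1 hheavy
    have h2 : (2 : ℝ) ^ k ≤ ∑ w ∈ W, (N w : ℝ) := by exact_mod_cast h1
    refine (mul_le_mul_of_nonneg_right h2 (by positivity)).trans ?_
    rw [Finset.sum_mul]
    exact (Finset.sum_le_sum fun w _ => hheavy w).trans (by simp)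
  -- Cubing removes the fractional exponent 2k/3: 8^k · 4^k = 32^k.
  have hcube := pow_le_pow_left₀ (by positivity) hcard 3
  have h4 : ((2 : ℝ) ^ (2 / 3 * (k : ℝ))) ^ 3 = 4 ^ k := by
    rw [← Real.rpow_natCast, ← Real.rpow_mul (by norm_num)]
    rw [show (2 / 3 * (k : ℝ)) * ((3 : ℕ) : ℝ) = 2 * k by push_cast; ring, Real.rpow_mul (by norm_num)]
    norm_num
  rw [mul_pow, h4, mul_pow, ← pow_mul, ← pow_mul, mul_comm k 3, pow_mul, pow_mul, ← mul_pow] at hcube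
  norm_num at hcube
  linarith

theorem exists_finset_lists_length_le (B : ℕ) :
    ∃ W : Finset (List Bool), (∀ w : List Bool, w.length ≤ B → w ∈ W) ∧ W.card ≤ 2 ^ (B + 1) := by
  refine ⟨(Finset.range (B + 1)).biUnion fun i =>
    (Finset.univ : Finset (Fin i → Bool)).image List.ofFn, ?_, ?_⟩
  · intro w hw
    simp only [Finset.mem_biUnion, Finset.mem_range, Finset.mem_image, Finset.mem_univ, true_and]
    exact ⟨w.length, by omega, w.get, List.ofFn_get w⟩
  · refine Finset.card_biUnion_le.trans ?_
    calc _ ≤ ∑ i ∈ Finset.range (B + 1), 2 ^ i := by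
          refine Finset.sum_le_sum fun i _ => Finset.card_image_le.trans ?_
          simp
      _ ≤ 2 ^ (B + 1) := (Nat.geomSum_lt (le_refl 2) (by simp)).le

theorem index_size_le {k B : ℕ} (h : (32 : ℝ) ^ k ≤ 27 ^ k * ((2 : ℝ) ^ (B + 1)) ^ 3) :
    k ≤ 13 * (B + 1) := by
  by_contra hlt
  push Not at hlt
  obtain ⟨r, rfl⟩ := Nat.exists_eq_add_of_lt hlt
  rw [show 13 * (B + 1) + r + 1 = 13 * (B + 1) + (r + 1) by ring, pow_add 32, pow_add 27,
    pow_mul 32, pow_mul 27] at h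
  -- 13 is the least exponent e with 8 · 27^e ≤ 32^e; the 8 is the cube of the factor 2 per memory
  -- bit.
  have h1 : ((27 : ℝ) ^ 13 * 8) ^ (B + 1) ≤ (32 ^ 13) ^ (B + 1) :=
    pow_le_pow_left₀ (by positivity) (by norm_num) _
  have h2 : (27 : ℝ) ^ (r + 1) < 32 ^ (r + 1) := pow_lt_pow_left₀ (by norm_num) (by norm_num) (by simp)
  have h3 : ((2 : ℝ) ^ (B + 1)) ^ 3 = 8 ^ (B + 1) := by
    rw [← pow_mul, mul_comm, pow_mul]; norm_num
  rw [h3] at h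
  rw [mul_pow] at h1
  have h4 : ((27 : ℝ) ^ 13) ^ (B + 1) * 8 ^ (B + 1) * 27 ^ (r + 1)
      < (32 ^ 13) ^ (B + 1) * 32 ^ (r + 1) :=
    mul_lt_mul' h1 h2 (by positivity) (by positivity)
  nlinarith

/-! ### Streams and frequencies -/

section Freq

variable {n : ℕ}

@[simp] theorem freq_nil (d : Fin n) : freq [] d = 0 := by simp [freq]

theorem freq_append (S T : UpdateStream n) (d : Fin n) : freq (S ++ T) d = freq S d + freq T d := by
  simp [freq]

theorem freq_singleton (u : Fin n × ℤ) (d : Fin n) :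
    freq [u] d = if u.1 = d then u.2 else 0 := by
  by_cases h : u.1 = d <;> simp [freq, h]

theorem freq_cons (u : Fin n × ℤ) (S : UpdateStream n) (d : Fin n) :
    freq (u :: S) d = (if u.1 = d then u.2 else 0) + freq S d := by
  rw [← freq_singleton, ← freq_append]; rfl

theorem freq_replicate (a d : Fin n) (t : ℕ) :
    freq (List.replicate t (a, (1 : ℤ))) d = if a = d then (t : ℤ) else 0 := by
  induction t with
  | zero => simp
  | succ t ih =>
    rw [List.replicate_succ, freq_cons, ih]
    split_ifs <;> simp
    ring

theorem freq_flatMap {α : Type*} (l : List α) (F : α → UpdateStream n) (d : Fin n) :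
    freq (l.flatMap F) d = (l.map fun a => freq (F a) d).sum := by
  induction l with
  | nil => simp
  | cons a l ih => simp [freq_append, ih]

/-- The insertion-only stream that inserts each item `d` exactly `g d` times. -/
def insertCounts (g : Fin n → ℕ) : UpdateStream n :=
  (List.finRange n).flatMap fun d => List.replicate (g d) (d, 1)

theorem freq_insertCounts (g : Fin n → ℕ) (d : Fin n) : freq (insertCounts g) d = g d := by
  rw [insertCounts, freq_flatMap]
  simp only [freq_replicate]
  rw [← List.ofFn_eq_map, List.sum_ofFn]
  simp

theorem insertCounts_snd (g : Fin n → ℕ) : ∀ u ∈ insertCounts g, u.2 = 1 := by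
  intro u hu
  simp only [insertCounts, List.mem_flatMap, List.mem_replicate] at hu
  obtain ⟨d, -, -, rfl⟩ := hu
  rfl

theorem freq_nonneg_of_insertions {S : UpdateStream n} (h : ∀ u ∈ S, u.2 = 1) (d : Fin n) :
    0 ≤ freq S d := by
  refine List.sum_nonneg fun z hz => ?_
  simp only [List.mem_map, List.mem_filter] at hz
  obtain ⟨u, ⟨hu, -⟩, rfl⟩ := hz
  simp [h u hu]

theorem natAbs_freq_le_of_prefix {S T : UpdateStream n} (h : ∀ u ∈ S ++ T, u.2 = 1) (d : Fin n) :
    (freq S d).natAbs ≤ (freq (S ++ T) d).natAbs := by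
  have h1 := freq_nonneg_of_insertions (S := S) (fun u hu => h u (by simp [hu])) d
  have h2 := freq_nonneg_of_insertions (S := T) (fun u hu => h u (by simp [hu])) d
  rw [freq_append]
  omega

theorem insertionOnly_of_append {m : ℕ} {S T : UpdateStream n} (h : S ++ T ∈ insertionOnly n m) :
    S ∈ insertionOnly n m :=
  ⟨fun u hu => h.1 u (by simp [hu]),
    (Finset.sum_le_sum fun d _ => natAbs_freq_le_of_prefix h.1 d).trans h.2⟩

theorem take_mem_insertionOnly {m : ℕ} {S : UpdateStream n} (h : S ∈ insertionOnly n m) (k : ℕ) :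
    S.take k ∈ insertionOnly n m := by
  rw [← List.take_append_drop k S] at h
  exact insertionOnly_of_append h

theorem insertionOnly_subset_turnstile (m : ℕ) : insertionOnly n m ⊆ turnstile n m := fun _ h => h.2

theorem natAbs_freq_le_l1Length (S : UpdateStream n) (d : Fin n) : (freq S d).natAbs ≤ l1Length S :=
  Finset.single_le_sum (f := fun d => (freq S d).natAbs) (fun _ _ => Nat.zero_le _)
    (Finset.mem_univ d)

theorem maxMagnitude_le_of_insertionOnly {m : ℕ} (hnm : n ≤ m) {S : UpdateStream n}
    (h : S ∈ insertionOnly n m) : maxMagnitude S ≤ m := by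
  refine max_le hnm (Finset.sup_le fun k _ => Finset.sup_le fun d _ => ?_)
  exact (natAbs_freq_le_l1Length _ d).trans (take_mem_insertionOnly h k).2

theorem natAbs_freq_take_le_maxMagnitude (S : UpdateStream n) (k : ℕ) (d : Fin n) :
    (freq (S.take k) d).natAbs ≤ maxMagnitude S := by
  rcases le_or_gt k S.length with hk | hk
  · refine le_max_of_le_right ?_
    exact (Finset.le_sup (f := fun d : Fin n => (freq (S.take k) d).natAbs) (Finset.mem_univ d)).trans
      (Finset.le_sup (f := fun k => Finset.univ.sup fun d : Fin n => (freq (S.take k) d).natAbs)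
        (Finset.mem_range.2 (by omega)))
  · rw [List.take_of_length_le hk.le, ← List.take_length (l := S)]
    refine le_max_of_le_right ?_
    rw [List.take_length]
    have := (Finset.le_sup (f := fun d : Fin n => (freq (S.take S.length) d).natAbs)
      (Finset.mem_univ d)).trans
      (Finset.le_sup (f := fun k => Finset.univ.sup fun d : Fin n => (freq (S.take k) d).natAbs)
        (Finset.mem_range.2 (Nat.lt_succ_self S.length)))
    simpa using this

theorem le_maxMagnitude (S : UpdateStream n) : n ≤ maxMagnitude S := le_max_left _ _

end Freq

/-! ### Splitting a run of an algorithm -/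

namespace Algorithm

variable {n : ℕ} (A : Algorithm n)

/-- The output distribution when `A` reads `S` starting with the memory contents `w`. -/
noncomputable def resultFrom (w : List Bool) (S : UpdateStream n) : PMF ℝ :=
  (S.foldl (fun μ u => μ.bind (A.step u)) (PMF.pure w)).bind A.output

theorem run_concat (S : UpdateStream n) (u : Fin n × ℤ) :
    A.run (S ++ [u]) = (A.run S).bind (A.step u) := by
  simp [run]

theorem foldl_bind (μ : PMF (List Bool)) (T : UpdateStream n) :
    T.foldl (fun μ u => μ.bind (A.step u)) μ =
      μ.bind fun w => T.foldl (fun μ u => μ.bind (A.step u)) (PMF.pure w) := by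
  induction T using List.reverseRecOn with
  | nil => simp
  | append_singleton T u ih => simp [ih, PMF.bind_bind]

/-- The past influences the output only through the memory contents, which thus act as the message
of a one-way protocol. -/
theorem result_append (S T : UpdateStream n) :
    A.result (S ++ T) = (A.run S).bind fun w => A.resultFrom w T := by
  rw [result, run, List.foldl_append, foldl_bind, PMF.bind_bind]
  rfl

theorem result_append_toMeasure (S T : UpdateStream n) {s : Set ℝ} (hs : MeasurableSet s) :
    (A.result (S ++ T)).toMeasure s = ∑' w, A.run S w * (A.resultFrom w T).toMeasure s := by
  rw [result_append, PMF.toMeasure_bind_apply _ _ _ hs]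

end Algorithm

/-! ### The lower bound -/

section LowerBound

theorem sum_range_eq_sum_pairs {α : Type*} [AddCommMonoid α] {n k : ℕ} (F : ℕ → α)
    (hF : ∀ d, 2 * k ≤ d → F d = 0) (hk : 2 * k ≤ n) :
    ∑ d ∈ Finset.range n, F d = ∑ j : Fin k, (F (2 * j) + F (2 * j + 1)) := by
  rw [Fin.sum_univ_eq_sum_range fun j => F (2 * j) + F (2 * j + 1)]
  have h1 : ∑ d ∈ Finset.range (2 * k), F d = ∑ d ∈ Finset.range n, F d := by
    refine Finset.sum_subset (Finset.range_subset_range.2 hk) fun d _ hd => hF d ?_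
    simpa using hd
  rw [← h1]
  clear h1 hF hk
  induction k with
  | zero => simp
  | succ k ih =>
    rw [show 2 * (k + 1) = 2 * k + 1 + 1 by ring, Finset.sum_range_succ, Finset.sum_range_succ, ih,
      Finset.sum_range_succ, add_assoc]

/-- How often each item is inserted by the first player, who encodes the bit `x j` by one copy of
the item `2 * j` or `2 * j + 1`. -/
def aliceCounts {k : ℕ} (x : Fin k → Bool) (d : ℕ) : ℕ :=
  if h : d / 2 < k then (if x ⟨d / 2, h⟩ = decide (d % 2 = 1) then 1 else 0) else 0

/-- How often each item is inserted by the second player, who asks for the bit with index `i`. -/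
def bobCounts {k : ℕ} (T : ℕ) (i : Fin k) (d : ℕ) : ℕ :=
  if d / 2 < k ∧ d ≠ 2 * i then T else 0

theorem aliceCounts_even {k : ℕ} (x : Fin k → Bool) (j : Fin k) :
    aliceCounts x (2 * j) = if x j then 0 else 1 := by
  have : (2 * (j : ℕ)) / 2 = j := by omega
  cases h : x j <;> simp [aliceCounts, this, h]

theorem aliceCounts_odd {k : ℕ} (x : Fin k → Bool) (j : Fin k) :
    aliceCounts x (2 * j + 1) = if x j then 1 else 0 := by
  have h1 : (2 * (j : ℕ) + 1) / 2 = j := by omega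
  have h2 : (2 * (j : ℕ) + 1) % 2 = 1 := by omega
  cases h : x j <;> simp [aliceCounts, h1, h2, h]

theorem bobCounts_even {k : ℕ} (T : ℕ) (i j : Fin k) :
    bobCounts T i (2 * j) = if j = i then 0 else T := by
  have : (2 * (j : ℕ)) / 2 = j := by omega
  simp [bobCounts, this, Fin.ext_iff]

theorem bobCounts_odd {k : ℕ} (T : ℕ) (i j : Fin k) : bobCounts T i (2 * j + 1) = T := by
  have h1 : (2 * (j : ℕ) + 1) / 2 = j := by omega
  have h2 : 2 * (j : ℕ) + 1 ≠ 2 * i := by omega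
  simp [bobCounts, h1, h2]

variable {n k : ℕ}

/-- The part of the stream contributed by the first player. -/
def aliceStream (n : ℕ) (x : Fin k → Bool) : UpdateStream n :=
  insertCounts fun d => aliceCounts x d

/-- The part of the stream contributed by the second player. -/
def bobStream (n T : ℕ) (i : Fin k) : UpdateStream n :=
  insertCounts fun d => bobCounts T i d

theorem freq_alice_bob (T : ℕ) (x : Fin k → Bool) (i : Fin k) (d : Fin n) :
    freq (aliceStream n x ++ bobStream n T i) d = ((aliceCounts x d + bobCounts T i d : ℕ) : ℤ) := by
  simp [freq_append, aliceStream, bobStream, freq_insertCounts]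

theorem counts_eq_zero (T : ℕ) (x : Fin k → Bool) (i : Fin k) (d : ℕ) (hd : 2 * k ≤ d) :
    aliceCounts x d + bobCounts T i d = 0 := by
  have : ¬ d / 2 < k := by omega
  simp [aliceCounts, bobCounts, this]

theorem alice_bob_mem_insertionOnly {m T : ℕ} (hk : 2 * k ≤ n) (hm : k * (2 * T + 1) ≤ m)
    (x : Fin k → Bool) (i : Fin k) : aliceStream n x ++ bobStream n T i ∈ insertionOnly n m := by
  refine ⟨fun u hu => ?_, ?_⟩
  · rcases List.mem_append.1 hu with h | h
    · exact insertCounts_snd _ u h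
    · exact insertCounts_snd _ u h
  · rw [l1Length]
    simp only [freq_alice_bob, Int.natAbs_natCast]
    rw [Fin.sum_univ_eq_sum_range fun d => aliceCounts x d + bobCounts T i d,
      sum_range_eq_sum_pairs _ (counts_eq_zero T x i) hk]
    refine le_trans (Finset.sum_le_card_nsmul _ _ (2 * T + 1) fun j _ => ?_) (by simpa using hm)
    rw [aliceCounts_even, aliceCounts_odd, bobCounts_even, bobCounts_odd]
    split_ifs <;> omega

/-- A pair other than i has frequencies T and T+1 in some order, whatever its bit, so the other bits
do not affect the moment. -/
theorem freqMoment_alice_bob {T : ℕ} (hT : 0 < T) (hk : 2 * k ≤ n) (p : ℝ)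
    (x : Fin k → Bool) (i : Fin k) :
    freqMoment p (aliceStream n x ++ bobStream n T i) =
      (if x i then ((T : ℝ) + 1) ^ p else 1 + (T : ℝ) ^ p) +
        ((k : ℝ) - 1) * ((T : ℝ) ^ p + ((T : ℝ) + 1) ^ p) := by
  set φ : ℕ → ℝ := fun v => if v = 0 then 0 else (v : ℝ) ^ p with hφ
  have h1 : freqMoment p (aliceStream n x ++ bobStream n T i) =
      ∑ d : Fin n, φ (aliceCounts x d + bobCounts T i d) := by
    rw [freqMoment, Finset.sum_filter]
    refine Finset.sum_congr rfl fun d _ => ?_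
    rw [freq_alice_bob, hφ]
    generalize aliceCounts x d + bobCounts T i d = v
    by_cases hv : v = 0 <;> simp [hv]
  have hz : ∀ d, 2 * k ≤ d → φ (aliceCounts x d + bobCounts T i d) = 0 := by
    intro d hd
    rw [counts_eq_zero T x i d hd]
    simp [hφ]
  rw [h1, Fin.sum_univ_eq_sum_range fun d => φ (aliceCounts x d + bobCounts T i d),
    sum_range_eq_sum_pairs _ hz hk, ← Finset.add_sum_erase _ _ (Finset.mem_univ i)]
  have hφT : φ T = (T : ℝ) ^ p := by simp [hφ, hT.ne']
  have hφT1 : φ (T + 1) = ((T : ℝ) + 1) ^ p := by simp [hφ]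
  have hφ1 : φ 1 = 1 := by simp [hφ]
  have hφ0 : φ 0 = 0 := by simp [hφ]
  congr 1
  · rw [aliceCounts_even, aliceCounts_odd, bobCounts_even, bobCounts_odd]
    cases x i
    · simp [hφT, hφ1]
    · simp [hφ0, add_comm 1 T, hφT1]
  · have hj : ∀ j ∈ Finset.univ.erase i, φ (aliceCounts x (2 * j) + bobCounts T i (2 * j)) +
        φ (aliceCounts x (2 * j + 1) + bobCounts T i (2 * j + 1)) =
        (T : ℝ) ^ p + ((T : ℝ) + 1) ^ p := by
      intro j hj
      rw [aliceCounts_even, aliceCounts_odd, bobCounts_even, bobCounts_odd,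
        if_neg (Finset.ne_of_mem_erase hj)]
      cases x j
      · simp only [Bool.false_eq_true, if_false, zero_add, add_comm 1 T, hφT, hφT1]
        ring
      · simp only [if_true, zero_add, add_comm 1 T, hφT, hφT1]
    have hkpos : 1 ≤ k := i.pos
    rw [Finset.sum_congr rfl hj, Finset.sum_const, Finset.card_erase_of_mem (Finset.mem_univ i),
      nsmul_eq_mul]
    simp [Nat.cast_sub hkpos]

/-- `hgap` makes the target intervals for the two values of the queried bit disjoint, so landing in
the right interval answers the query with probability at least 2/3. -/
theorem index_reduction {m T : ℕ} (hT : 0 < T) (hk : 2 * k ≤ n) (hm : k * (2 * T + 1) ≤ m)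
    {p ε : ℝ} (hp : p < 0) (hε : 0 < ε) (hε2 : ε ≤ 1 / 2) (hgap : 8 * (ε * (k * (T : ℝ) ^ p)) < 1)
    (A : Algorithm n) (hA : A.Approximates (insertionOnly n m) ε p) {b : ℝ}
    (hb : ∀ S ∈ insertionOnly n m, A.StorageAtMost S b) : k ≤ 13 * (⌊b⌋₊ + 1) := by
  obtain ⟨W, hW, hWcard⟩ := exists_finset_lists_length_le ⌊b⌋₊
  rcases Nat.eq_zero_or_pos k with rfl | hkpos
  · simp
  set u : ℝ := (T : ℝ) ^ p with hu
  set v : ℝ := ((T : ℝ) + 1) ^ p with hv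
  have hTR : (0 : ℝ) < T := by exact_mod_cast hT
  have hvu : v ≤ u := Real.rpow_le_rpow_of_nonpos hTR (by linarith) hp.le
  have hv0 : 0 ≤ v := by positivity
  have hu0 : 0 ≤ u := by positivity
  have hk1 : (1 : ℝ) ≤ k := by exact_mod_cast hkpos
  set F : Bool → ℝ := fun β => (if β then v else 1 + u) + ((k : ℝ) - 1) * (u + v) with hF
  let I : Bool → Set ℝ := fun β => Set.Icc ((1 - ε) * F β) ((1 + ε) * F β)
  -- The two moments differ by at least 1, while ε times their sum is at most ε + 4εkT^p, which is
  -- less than 1/2 + 1/2.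
  have hsep : (1 + ε) * F true < (1 - ε) * F false := by
    simp only [hF, if_true, Bool.false_eq_true, if_false]
    have h1 : ((k : ℝ) - 1) * (u + v) ≤ ((k : ℝ) - 1) * (2 * u) :=
      mul_le_mul_of_nonneg_left (by linarith) (by linarith)
    have h2 : ε * (((k : ℝ) - 1) * (u + v)) ≤ ε * (((k : ℝ) - 1) * (2 * u)) :=
      mul_le_mul_of_nonneg_left h1 hε.le
    have h3 : (1 + ε) * v ≤ (1 + ε) * u := mul_le_mul_of_nonneg_left hvu (by linarith)
    have h4 : 0 ≤ ε * (k * u) := by positivity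
    have h5 : 0 ≤ ε * u := by positivity
    linarith
  have hdisj : Disjoint (I false) (I true) := by
    rw [Set.disjoint_left]
    intro y hy1 hy2
    exact absurd (hy1.1.trans hy2.2) (not_le.2 hsep)
  let D : (Fin k → Bool) → PMF (List Bool) := fun x => A.run (aliceStream n x)
  let g : List Bool → Fin k → Bool → ℝ≥0∞ := fun w i β =>
    (A.resultFrom w (bobStream n T i)).toMeasure (I β)
  have hD : ∀ x, (D x).support ⊆ W := by
    intro x w hw
    have hmem := alice_bob_mem_insertionOnly (n := n) (T := T) hk hm x ⟨0, hkpos⟩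
    have hlen := hb _ (insertionOnly_of_append hmem) (aliceStream n x).length le_rfl w
      (by rw [List.take_length]; exact hw)
    exact hW w (Nat.le_floor hlen)
  have hg : ∀ w i, g w i false + g w i true ≤ 1 := by
    intro w i
    rw [← MeasureTheory.measure_union hdisj measurableSet_Icc]
    exact MeasureTheory.prob_le_one
  have hsucc : ∀ x i, 2 / 3 ≤ ∑' w, D x w * g w i (x i) := by
    intro x i
    have h := hA _ (alice_bob_mem_insertionOnly (n := n) (T := T) hk hm x i)
    rw [freqMoment_alice_bob hT hk, A.result_append_toMeasure _ _ measurableSet_Icc] at h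
    exact h
  have h32 := index_lower_bound W D hD g hg hsucc
  refine index_size_le (h32.trans (mul_le_mul_of_nonneg_left ?_ (by positivity)))
  have hWcardR : (W.card : ℝ) ≤ 2 ^ (⌊b⌋₊ + 1) := by exact_mod_cast hWcard
  exact pow_le_pow_left₀ (Nat.cast_nonneg _) hWcardR 3

/-- Without a single bit the memory is always empty, so the empty stream and one insertion have the
same output law, although their target intervals are disjoint. This settles the case of a small
minimum and absorbs the additive constants of the index bound. -/
theorem one_le_storage {m : ℕ} (hn : 1 ≤ n) (hnm : n ≤ m) {p ε : ℝ} (hε2 : ε ≤ 1 / 2)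
    (A : Algorithm n) (hA : A.Approximates (insertionOnly n m) ε p) {b : ℝ}
    (hb : ∀ S ∈ insertionOnly n m, A.StorageAtMost S b) : 1 ≤ b := by
  by_contra hlt
  push Not at hlt
  let S : UpdateStream n := [(⟨0, hn⟩, 1)]
  have hS : S ∈ insertionOnly n m := by
    refine ⟨by simp [S], ?_⟩
    have : ∀ d : Fin n, (freq S d).natAbs ≤ 1 := by
      intro d
      rw [freq_singleton]
      split_ifs <;> simp
    refine (Finset.sum_le_sum fun d _ => this d).trans ?_
    simpa using hnm
  have hnil : ([] : UpdateStream n) ∈ insertionOnly n m := ⟨by simp, by simp [l1Length]⟩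
  have hrun : ∀ T ∈ insertionOnly n m, A.run T = PMF.pure [] := by
    intro T hT
    have hsupp : (A.run T).support ⊆ {[]} := by
      intro w hw
      have := hb T hT T.length le_rfl w (by rwa [List.take_length])
      have h0 : (w.length : ℝ) < 1 := this.trans_lt hlt
      have h1 : w.length < 1 := by exact_mod_cast h0
      simpa using h1
    ext w
    by_cases hw : w = []
    · subst hw
      have hsub := hsupp
      rw [PMF.pure_apply, if_pos rfl]
      exact ((A.run T).apply_eq_one_iff []).2
        ((Set.Nonempty.subset_singleton_iff (A.run T).support_nonempty).1 hsub)
    · rw [PMF.pure_apply, if_neg hw]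
      by_contra hne
      exact hw (hsupp ((PMF.mem_support_iff _ _).2 hne))
  have hres : A.result S = A.result [] := by
    rw [Algorithm.result, Algorithm.result, hrun S hS, hrun [] hnil]
  have h1 := hA S hS
  have h2 := hA [] hnil
  have hF0 : freqMoment p ([] : UpdateStream n) = 0 := by simp [freqMoment]
  have hF1 : freqMoment p S = 1 := by
    rw [freqMoment, Finset.sum_eq_single (⟨0, hn⟩ : Fin n)]
    · simp [S, freq_singleton]
    · intro d hd hne
      simp [S, freq_singleton, hne.symm] at hd
    · simp [S, freq_singleton]
  rw [hF0] at h2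
  rw [hres, hF1] at h1
  have hdisj : Disjoint (Set.Icc ((1 - ε) * 0) ((1 + ε) * 0)) (Set.Icc ((1 - ε) * 1) ((1 + ε) * 1)) := by
    rw [Set.disjoint_left]
    intro y hy1 hy2
    linarith [hy1.2, hy2.1]
  have h3 := MeasureTheory.measure_union (μ := (A.result []).toMeasure) hdisj measurableSet_Icc
  have h4 : (A.result []).toMeasure (Set.Icc ((1 - ε) * 0) ((1 + ε) * 0) ∪
    Set.Icc ((1 - ε) * 1) ((1 + ε) * 1)) ≤ 1 := MeasureTheory.prob_le_one
  rw [h3] at h4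
  have h5 := (add_le_add h2 h1).trans h4
  have h6 := ENNReal.toReal_mono ENNReal.one_ne_top h5
  rw [ENNReal.toReal_add (by simp [ENNReal.div_eq_top]) (by simp [ENNReal.div_eq_top])] at h6
  norm_num at h6

theorem storage_lower_bound {m : ℕ} (hn : 1 ≤ n) (hnm : n ≤ m) {p ε : ℝ} (hp : p < 0) (hε : 0 < ε)
    (hε2 : ε ≤ 1 / 2) (A : Algorithm n) (hA : A.Approximates (insertionOnly n m) ε p) {b : ℝ}
    (hb : ∀ S ∈ insertionOnly n m, A.StorageAtMost S b) :
    1 / 1000 * min (n : ℝ) (ε ^ (-1 / (1 - p)) * (m : ℝ) ^ (-p / (1 - p))) ≤ b := by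
  have hb1 := one_le_storage hn hnm hε2 A hA hb
  set K : ℝ := ε ^ (-1 / (1 - p)) * (m : ℝ) ^ (-p / (1 - p)) with hK
  set μ : ℝ := min (n : ℝ) K with hμ
  have hm0 : (0 : ℝ) < m := by exact_mod_cast (by omega : 0 < m)
  have hK0 : 0 < K := by positivity
  have hn0 : (0 : ℝ) < n := by exact_mod_cast hn
  have hμ0 : 0 < μ := lt_min hn0 hK0
  rcases lt_or_ge μ 16 with hsmall | hlarge
  · linarith
  -- The factor 16 leaves room for 8k ≤ K/2, which yields a strict gap, and for 2k ≤ n.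
  set k : ℕ := ⌊μ / 16⌋₊ with hkdef
  have hkle : (k : ℝ) ≤ μ / 16 := Nat.floor_le (by positivity)
  have hkgt : μ / 16 < k + 1 := Nat.lt_floor_add_one _
  have hk1 : 1 ≤ k := Nat.le_floor (by push_cast; linarith)
  have hk1R : (1 : ℝ) ≤ k := by exact_mod_cast hk1
  have h16 : 16 * k ≤ n := by
    have : (16 * k : ℝ) ≤ n := by linarith [min_le_left (n : ℝ) K]
    exact_mod_cast this
  -- The stream length is at most k(2T+1) ≤ 4kT ≤ m, and rounding still leaves T > m/(8k).
  set T : ℕ := m / (4 * k) with hTdef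
  have hT4 : T * (4 * k) ≤ m := Nat.div_mul_le_self _ _
  have hTpos : 0 < T := Nat.div_pos (by omega) (by omega)
  have hTlow : m < 8 * k * T := by
    have h1 : m < 4 * k * (T + 1) := by
      have := Nat.lt_mul_div_succ m (show 0 < 4 * k by omega)
      simpa [hTdef] using this
    nlinarith
  have hq : 0 < 1 - p := by linarith
  have hKpow : K ^ (1 - p) = ε⁻¹ * (m : ℝ) ^ (-p) := by
    rw [hK, Real.mul_rpow (by positivity) (by positivity), ← Real.rpow_mul hε.le,
      ← Real.rpow_mul hm0.le, div_mul_cancel₀ _ hq.ne', div_mul_cancel₀ _ hq.ne', Real.rpow_neg_one]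
  have hgap : 8 * (ε * (k * (T : ℝ) ^ p)) < 1 := by
    have hT8 : (T : ℝ) ^ p ≤ (m / (8 * k)) ^ p := by
      refine Real.rpow_le_rpow_of_nonpos (by positivity) ?_ hp.le
      rw [div_le_iff₀ (by positivity)]
      have : (m : ℝ) < 8 * k * T := by exact_mod_cast hTlow
      linarith
    have h8 : ((m : ℝ) / (8 * k)) ^ p = (8 * k : ℝ) ^ (-p) * (m : ℝ) ^ p := by
      rw [Real.div_rpow hm0.le (by positivity), Real.rpow_neg (by positivity)]
      field_simp
    have h9 : 8 * ((k : ℝ) * (8 * k : ℝ) ^ (-p)) = (8 * k : ℝ) ^ (1 - p) := by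
      rw [sub_eq_add_neg, Real.rpow_add (by positivity), Real.rpow_one]
      ring
    have h10 : (8 * k : ℝ) ^ (1 - p) ≤ (K / 2) ^ (1 - p) :=
      Real.rpow_le_rpow (by positivity) (by linarith [min_le_right (n : ℝ) K]) hq.le
    have h11 : (K / 2) ^ (1 - p) < K ^ (1 - p) :=
      Real.rpow_lt_rpow (by positivity) (by linarith) hq
    calc 8 * (ε * (k * (T : ℝ) ^ p)) ≤ 8 * (ε * (k * ((8 * k : ℝ) ^ (-p) * (m : ℝ) ^ p))) := by
          rw [← h8]; gcongr
      _ = ε * (8 * ((k : ℝ) * (8 * k : ℝ) ^ (-p))) * (m : ℝ) ^ p := by ring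
      _ = ε * (8 * k : ℝ) ^ (1 - p) * (m : ℝ) ^ p := by rw [h9]
      _ < ε * (ε⁻¹ * (m : ℝ) ^ (-p)) * (m : ℝ) ^ p := by
          rw [← hKpow]
          have := h10.trans_lt h11
          gcongr
      _ = 1 := by
          rw [Real.rpow_neg hm0.le]
          field_simp
  have hmk : k * (2 * T + 1) ≤ m := by nlinarith
  have hfin := index_reduction hTpos (by omega) hmk hp hε hε2 hgap A hA hb
  have hfl : (⌊b⌋₊ : ℝ) ≤ b := Nat.floor_le (by linarith)
  have hfinR : (k : ℝ) ≤ 13 * (⌊b⌋₊ + 1) := by exact_mod_cast hfin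
  linarith

end LowerBound

/-! ### Self-delimiting codes for lists of integers -/

/-- A self-delimiting code of a bit string: every bit is preceded by `true`, and `false` marks
the end. -/
def encodeBits : List Bool → List Bool
  | [] => [false]
  | b :: l => true :: b :: encodeBits l

theorem length_encodeBits (l : List Bool) : (encodeBits l).length = 2 * l.length + 1 := by
  induction l with
  | nil => rfl
  | cons b l ih => simp only [encodeBits, List.length_cons, ih]; ring

theorem encodeBits_append_inj {l l' r r' : List Bool}
    (h : encodeBits l ++ r = encodeBits l' ++ r') : l = l' ∧ r = r' := by
  induction l generalizing l' with
  | nil => cases l' <;> simp_all [encodeBits]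
  | cons b l ih =>
    cases l' with
    | nil => simp [encodeBits] at h
    | cons b' l' =>
      simp only [encodeBits, List.cons_append, List.cons.injEq, true_and] at h
      obtain ⟨h1, h2⟩ := ih h.2
      exact ⟨by rw [h.1, h1], h2⟩

/-- The natural number that codes an integer. -/
def intCode (z : ℤ) : ℕ := if 0 ≤ z then 2 * z.natAbs else 2 * z.natAbs + 1

theorem intCode_injective : Function.Injective intCode := by
  intro a b h
  simp only [intCode] at h
  split_ifs at h <;> omega

theorem intCode_le (z : ℤ) : intCode z ≤ 2 * z.natAbs + 1 := by
  rw [intCode]; split_ifs <;> omega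

/-- The self-delimiting code of an integer. -/
def encodeInt (z : ℤ) : List Bool := encodeBits (intCode z).bits

theorem bits_injective : Function.Injective Nat.bits := by
  intro a b h
  refine Nat.eq_of_testBit_eq fun i => ?_
  rw [Nat.testBit_eq_inth, Nat.testBit_eq_inth, h]

/-- The code of a list of integers. -/
def encodeList (l : List ℤ) : List Bool := l.flatMap encodeInt

theorem encodeList_injective : Function.Injective encodeList := by
  have hne : ∀ z l, encodeInt z ++ l ≠ [] := by
    intro z l
    rw [encodeInt]
    cases (intCode z).bits <;> simp [encodeBits]
  intro l
  induction l with
  | nil =>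
    intro l' h
    cases l' with
    | nil => rfl
    | cons z l' => exact absurd h.symm (hne z _)
  | cons z l ih =>
    intro l' h
    cases l' with
    | nil => exact absurd h (hne z _)
    | cons z' l' =>
      obtain ⟨h1, h2⟩ := encodeBits_append_inj (l := (intCode z).bits) (l' := (intCode z').bits)
        (r := encodeList l) (r' := encodeList l') h
      rw [intCode_injective (bits_injective h1), ih h2]

/-- The exponent 4 accommodates the largest integers ever stored, the linear measurements bounded in
`natAbs_sketch_le`. -/
theorem length_encodeInt_le {μ : ℕ} (hμ : 2 ≤ μ) {z : ℤ} (hz : z.natAbs ≤ μ ^ 4) :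
    ((encodeInt z).length : ℝ) ≤ 32 * Real.log μ := by
  have hL : μ < 2 ^ (Nat.log 2 μ + 1) := Nat.lt_pow_succ_log_self (by norm_num) μ
  have hcode : intCode z < 2 ^ (4 * (Nat.log 2 μ + 1) + 2) := by
    have h1 : μ ^ 4 ≤ (2 ^ (Nat.log 2 μ + 1)) ^ 4 := Nat.pow_le_pow_left hL.le 4
    rw [pow_add 2 (4 * _), mul_comm 4 (_ + 1), pow_mul]
    have h2 := intCode_le z
    have h3 : 1 ≤ μ ^ 4 := Nat.one_le_pow _ _ (by omega)
    omega
  have hlen : (encodeInt z).length ≤ 2 * (4 * (Nat.log 2 μ + 1) + 2) + 1 := by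
    rw [encodeInt, length_encodeBits, Nat.size_eq_bits_len]
    have := Nat.size_le.2 hcode
    omega
  have hlog : (Nat.log 2 μ : ℝ) * Real.log 2 ≤ Real.log μ := by
    rw [← Real.log_pow]
    refine Real.log_le_log (by positivity) ?_
    exact_mod_cast Nat.pow_log_le_self 2 (by omega)
  have hlog2 := Real.log_two_gt_d9
  have hμlog : Real.log 2 ≤ Real.log μ := Real.log_le_log two_pos (by exact_mod_cast hμ)
  have hlenR : ((encodeInt z).length : ℝ) ≤ 2 * (4 * (Nat.log 2 μ + 1) + 2) + 1 := by
    exact_mod_cast hlen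
  have : (Nat.log 2 μ : ℝ) * 0.69 ≤ Real.log μ :=
    le_trans (mul_le_mul_of_nonneg_left (by linarith) (by positivity)) hlog
  linarith

theorem length_encodeList_le {μ : ℕ} (hμ : 2 ≤ μ) {l : List ℤ}
    (hl : ∀ z ∈ l, z.natAbs ≤ μ ^ 4) :
    ((encodeList l).length : ℝ) ≤ l.length * (32 * Real.log μ) := by
  induction l with
  | nil => simp [encodeList]
  | cons z l ih =>
    have h1 := length_encodeInt_le hμ (hl z (by simp))
    have h2 := ih fun y hy => hl y (by simp [hy])
    have h3 : (encodeList (z :: l)).length = (encodeInt z).length + (encodeList l).length := by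
      simp [encodeList]
    rw [h3]
    push_cast
    rw [List.length_cons]
    push_cast
    linarith

/-! ### Algorithms with deterministic updates -/

section StateAlgorithm

variable {n : ℕ} {σ Ω : Type}

/-- The state after reading a stream. -/
def finalState (upd : Fin n × ℤ → σ → σ) (s : σ) (S : UpdateStream n) : σ :=
  S.foldl (fun s u => upd u s) s

theorem finalState_concat (upd : Fin n × ℤ → σ → σ) (s : σ) (S : UpdateStream n)
    (u : Fin n × ℤ) : finalState upd s (S ++ [u]) = upd u (finalState upd s S) := by
  simp [finalState]

variable [Nonempty σ] [Fintype Ω] [Nonempty Ω]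

/-- The algorithm that starts in the state `start ω` for a uniformly random seed `ω`, updates the
state deterministically by `upd`, and keeps the state in the memory under the code `enc`. -/
noncomputable def stateAlgorithm (start : Ω → σ) (upd : Fin n × ℤ → σ → σ) (out : σ → ℝ)
    (enc : σ → List Bool) : Algorithm n where
  init := (PMF.uniformOfFintype Ω).map fun ω => enc (start ω)
  step u w := PMF.pure (enc (upd u (Function.invFun enc w)))
  output w := PMF.pure (out (Function.invFun enc w))

variable {start : Ω → σ} {upd : Fin n × ℤ → σ → σ} {out : σ → ℝ} {enc : σ → List Bool}

/-- Injectivity makes `Function.invFun enc` a faithful decoder, so the only randomness is the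
initial seed, and success probabilities become counts of seeds. -/
theorem stateAlgorithm_run (henc : Function.Injective enc) (S : UpdateStream n) :
    (stateAlgorithm start upd out enc).run S =
      (PMF.uniformOfFintype Ω).map fun ω => enc (finalState upd (start ω) S) := by
  induction S using List.reverseRecOn with
  | nil => rfl
  | append_singleton S u ih =>
    rw [Algorithm.run_concat, ih, PMF.bind_map]
    change _ = PMF.bind _ (PMF.pure ∘ _)
    congr 1
    funext ω
    simp only [Function.comp_apply, stateAlgorithm, Function.leftInverse_invFun henc _,
      finalState_concat]

theorem stateAlgorithm_result (henc : Function.Injective enc) (S : UpdateStream n) :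
    (stateAlgorithm start upd out enc).result S =
      (PMF.uniformOfFintype Ω).map fun ω => out (finalState upd (start ω) S) := by
  rw [Algorithm.result, stateAlgorithm_run henc, PMF.bind_map]
  change _ = PMF.bind _ (PMF.pure ∘ _)
  congr 1
  funext ω
  simp only [Function.comp_apply, stateAlgorithm, Function.leftInverse_invFun henc _]

theorem stateAlgorithm_storageAtMost (henc : Function.Injective enc) {S : UpdateStream n} {b : ℝ}
    (h : ∀ k, ∀ ω, ((enc (finalState upd (start ω) (S.take k))).length : ℝ) ≤ b) :
    (stateAlgorithm start upd out enc).StorageAtMost S b := by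
  intro k _ w hw
  rw [stateAlgorithm_run henc, PMF.mem_support_map_iff] at hw
  obtain ⟨ω, -, rfl⟩ := hw
  exact h k ω

open Classical in
theorem stateAlgorithm_approximates (henc : Function.Injective enc) {X : Set (UpdateStream n)}
    {ε p : ℝ} (h : ∀ S ∈ X, 3 * (Finset.univ.filter fun ω => ¬ out (finalState upd (start ω) S) ∈
      Set.Icc ((1 - ε) * freqMoment p S) ((1 + ε) * freqMoment p S)).card ≤ Fintype.card Ω) :
    (stateAlgorithm start upd out enc).Approximates X ε p := by
  intro S hS
  rw [stateAlgorithm_result henc, PMF.toMeasure_apply_eq_toOuterMeasure_apply _ measurableSet_Icc,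
    PMF.toOuterMeasure_map_apply, PMF.toOuterMeasure_uniformOfFintype_apply]
  have h1 := h S hS
  set I := Set.Icc ((1 - ε) * freqMoment p S) ((1 + ε) * freqMoment p S)
  have h2 := Finset.card_filter_add_card_filter_not (s := (Finset.univ : Finset Ω))
    (fun ω => out (finalState upd (start ω) S) ∈ I)
  have h3 : Fintype.card ((fun ω => out (finalState upd (start ω) S)) ⁻¹' I) =
      (Finset.univ.filter fun ω => out (finalState upd (start ω) S) ∈ I).card := by
    rw [← Set.toFinset_card]
    congr 1
    ext ω
    simp
  rw [h3, ENNReal.le_div_iff_mul_le (by simp) (by simp), mul_comm, ← mul_div_assoc,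
    ENNReal.div_le_iff_le_mul (by simp) (by simp)]
  rw [Finset.card_univ] at h2
  have h4 : 2 * Fintype.card Ω ≤
      3 * (Finset.univ.filter fun ω => out (finalState upd (start ω) S) ∈ I).card := by
    have h5 : 3 * (Finset.univ.filter fun ω => ¬ out (finalState upd (start ω) S) ∈ I).card ≤
        Fintype.card Ω := by convert h1
    omega
  rw [mul_comm 2, mul_comm 3] at h4
  exact_mod_cast h4

end StateAlgorithm

/-! ### Pairwise independent sampling -/

section Hashing

variable {n P : ℕ}

/-- The seeds of the hash functions. -/
abbrev Seed (P : ℕ) : Type := ZMod P × ZMod P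

/-- The hash value `a * d + b` in `ℤ/P`, as a natural number below `P`. -/
def hash (ω : Seed P) (d : Fin n) : ℕ := (ω.1 * ((d : ℕ) : ZMod P) + ω.2).val

/-- The indicator of the event that the hash value of `d` is less than `t`. -/
def sampled (t : ℕ) (ω : Seed P) (d : Fin n) : ℝ := if hash ω d < t then 1 else 0

variable [hP : Fact P.Prime]

theorem sum_indicator_val_lt {t : ℕ} (ht : t ≤ P) :
    ∑ z : ZMod P, (if z.val < t then (1 : ℝ) else 0) = t := by
  have h : ∑ z : ZMod P, (if z.val < t then (1 : ℝ) else 0) =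
      ∑ i ∈ Finset.range P, if i < t then (1 : ℝ) else 0 := by
    refine Finset.sum_bij (fun z _ => z.val) (fun z _ => Finset.mem_range.2 z.val_lt)
      (fun a _ b _ h => ZMod.val_injective P h) (fun i hi => ⟨(i : ZMod P), Finset.mem_univ _,
        ZMod.val_cast_of_lt (Finset.mem_range.1 hi)⟩) (fun _ _ => rfl)
  rw [h, ← Finset.sum_filter, Finset.sum_const, nsmul_eq_mul, mul_one]
  congr 1
  have : (Finset.range P).filter (· < t) = Finset.range t := by
    ext i
    simp only [Finset.mem_filter, Finset.mem_range]
    omega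
  rw [this, Finset.card_range]

theorem sum_sampled {t : ℕ} (ht : t ≤ P) (d : Fin n) :
    ∑ ω : Seed P, sampled t ω d = P * t := by
  rw [Fintype.sum_prod_type]
  have : ∀ a : ZMod P, ∑ b : ZMod P, sampled t (a, b) d = t := by
    intro a
    rw [← sum_indicator_val_lt ht, ← Equiv.sum_comp (Equiv.addLeft (a * ((d : ℕ) : ZMod P)))
      (fun z : ZMod P => if z.val < t then (1 : ℝ) else 0)]
    rfl
  simp [this]

theorem natCast_sub_ne_zero (hn : n ≤ P) {d e : Fin n} (hde : d ≠ e) :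
    ((d : ℕ) : ZMod P) - ((e : ℕ) : ZMod P) ≠ 0 := by
  intro h
  apply hde
  rw [sub_eq_zero] at h
  have := congrArg ZMod.val h
  rw [ZMod.val_cast_of_lt (d.2.trans_le hn), ZMod.val_cast_of_lt (e.2.trans_le hn)] at this
  exact Fin.ext this

/-- Pairwise independence: for distinct residues d, e the map (a, b) ↦ (ad+b, ae+b) is a bijection
of (ℤ/P)². -/
theorem sum_sampled_mul (hn : n ≤ P) {t : ℕ} (ht : t ≤ P) {d e : Fin n} (hde : d ≠ e) :
    ∑ ω : Seed P, sampled t ω d * sampled t ω e = t * t := by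
  have hne := natCast_sub_ne_zero hn hde
  have hbij : Function.Bijective (fun ω : Seed P =>
      ((ω.1 * ((d : ℕ) : ZMod P) + ω.2, ω.1 * ((e : ℕ) : ZMod P) + ω.2) : ZMod P × ZMod P)) := by
    rw [Fintype.bijective_iff_injective_and_card]
    refine ⟨?_, rfl⟩
    rintro ⟨a, b⟩ ⟨a', b'⟩ h
    simp only [Prod.mk.injEq] at h
    obtain ⟨h1, h2⟩ := h
    have h3 : (a - a') * (((d : ℕ) : ZMod P) - ((e : ℕ) : ZMod P)) = 0 := by
      linear_combination h1 - h2
    have h4 : a = a' := sub_eq_zero.1 ((mul_eq_zero.1 h3).resolve_right hne)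
    subst h4
    simpa using h1
  have h := hbij.sum_comp (fun uv : ZMod P × ZMod P =>
    (if uv.1.val < t then (1 : ℝ) else 0) * (if uv.2.val < t then (1 : ℝ) else 0))
  refine Eq.trans h ?_
  rw [Fintype.sum_prod_type]
  have h5 := Finset.sum_mul_sum Finset.univ Finset.univ
    (fun z : ZMod P => if z.val < t then (1 : ℝ) else 0)
    (fun z : ZMod P => if z.val < t then (1 : ℝ) else 0)
  rw [sum_indicator_val_lt ht] at h5
  exact h5.symm

/-- The covariances vanish, so only the P² · (t/P)(1 - t/P) of each diagonal term survives. -/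
theorem sum_sq_deviation (hn : n ≤ P) {t : ℕ} (ht : t ≤ P) (w : Fin n → ℝ) :
    ∑ ω : Seed P, (∑ d, w d * sampled t ω d - t / P * ∑ d, w d) ^ 2 ≤ P * t * ∑ d, w d ^ 2 := by
  have hP0 : (P : ℝ) ≠ 0 := by exact_mod_cast hP.out.ne_zero
  have hcov : ∀ d e : Fin n, ∑ ω : Seed P, (sampled t ω d - t / P) * (sampled t ω e - t / P) =
      if d = e then (P * t - t * t : ℝ) else 0 := by
    intro d e
    have hexp : ∀ ω : Seed P, (sampled t ω d - t / P) * (sampled t ω e - t / P) =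
        sampled t ω d * sampled t ω e - t / P * sampled t ω d - t / P * sampled t ω e
          + (t / P) * (t / P) := fun ω => by ring
    have hcard : (Fintype.card (Seed P) : ℝ) = P * P := by simp [Seed, ZMod.card]
    simp_rw [hexp, Finset.sum_add_distrib, Finset.sum_sub_distrib, ← Finset.mul_sum,
      sum_sampled ht]
    rw [Finset.sum_const, Finset.card_univ, nsmul_eq_mul, hcard]
    split_ifs with hde
    · subst hde
      have hsq : ∀ ω : Seed P, sampled t ω d * sampled t ω d = sampled t ω d := by
        intro ω; rw [sampled]; split_ifs <;> simp
      simp_rw [hsq, sum_sampled ht]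
      field_simp
      ring
    · rw [sum_sampled_mul hn ht hde]
      field_simp
      ring
  calc ∑ ω : Seed P, (∑ d, w d * sampled t ω d - t / P * ∑ d, w d) ^ 2
      = ∑ ω : Seed P, ∑ d, ∑ e, w d * w e *
          ((sampled t ω d - t / P) * (sampled t ω e - t / P)) := by
        refine Finset.sum_congr rfl fun ω _ => ?_
        rw [Finset.mul_sum, ← Finset.sum_sub_distrib, sq, Finset.sum_mul_sum]
        exact Finset.sum_congr rfl fun d _ => Finset.sum_congr rfl fun e _ => by ring
    _ = ∑ d, ∑ e, w d * w e * if d = e then (P * t - t * t : ℝ) else 0 := by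
        rw [Finset.sum_comm]
        refine Finset.sum_congr rfl fun d _ => ?_
        rw [Finset.sum_comm]
        refine Finset.sum_congr rfl fun e _ => ?_
        rw [← Finset.mul_sum, hcov]
    _ = ∑ d, w d ^ 2 * (P * t - t * t : ℝ) := by
        refine Finset.sum_congr rfl fun d _ => ?_
        simp [sq]
    _ ≤ P * t * ∑ d, w d ^ 2 := by
        rw [← Finset.sum_mul, mul_comm]
        refine mul_le_mul_of_nonneg_right ?_ (Finset.sum_nonneg fun d _ => sq_nonneg _)
        nlinarith [sq_nonneg (t : ℝ)]

theorem card_mul_le_sum {Ω : Type*} [Fintype Ω] (X : Ω → ℝ) (hX : ∀ ω, 0 ≤ X ω) (a : ℝ)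
    (p : Ω → Prop) [DecidablePred p] (hp : ∀ ω, p ω → a ≤ X ω) :
    ((Finset.univ.filter p).card : ℝ) * a ≤ ∑ ω, X ω := by
  rw [← nsmul_eq_mul, ← Finset.sum_const]
  exact (Finset.sum_le_sum fun ω hω => hp ω (Finset.mem_filter.1 hω).2).trans
    (Finset.sum_le_univ_sum_of_nonneg hX)

/-- The threshold for the hash values of the items that survive on level `j`. -/
def threshold (P j : ℕ) : ℕ := P / 2 ^ j

omit hP in
theorem threshold_le (j : ℕ) : threshold P j ≤ P := Nat.div_le_self _ _

theorem threshold_ratio_le (j : ℕ) : (threshold P j : ℝ) / P ≤ 1 / 2 ^ j := by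
  have hP0 : (0 : ℝ) < P := by exact_mod_cast hP.out.pos
  rw [div_le_div_iff₀ hP0 (by positivity), one_mul]
  exact_mod_cast Nat.div_mul_le_self P (2 ^ j)

/-- Rounding the threshold down costs at most a factor 2 while it stays positive. It causes no bias,
since `estimate` divides by the true sampling rate. -/
theorem le_threshold_ratio {j : ℕ} (hj : 2 ^ j ≤ P) :
    1 / (2 * 2 ^ j) ≤ (threshold P j : ℝ) / P := by
  have hP0 : (0 : ℝ) < P := by exact_mod_cast hP.out.pos
  rw [div_le_div_iff₀ (by positivity) hP0, one_mul]
  have h1 : 0 < threshold P j := Nat.div_pos hj (by positivity)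
  have h2 : P < 2 ^ j * (threshold P j + 1) := Nat.lt_mul_div_succ P (by positivity)
  have h3 : P ≤ threshold P j * (2 * 2 ^ j) := by nlinarith [Nat.one_le_two_pow (n := j)]
  exact_mod_cast h3

-- Chebyshev's inequality. Weights in [0,1] satisfy w² ≤ w, so the variance is at most the mean.
open Classical in
theorem card_deviation_le (hn : n ≤ P) {j : ℕ} (hj : 2 ^ j ≤ P) {w : Fin n → ℝ}
    (hw0 : ∀ d, 0 ≤ w d) (hw1 : ∀ d, w d ≤ 1) (hW : 0 < ∑ d, w d) {η : ℝ} (hη : 0 < η) :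
    ((Finset.univ.filter fun ω : Seed P => η * ((threshold P j : ℝ) / P * ∑ d, w d) <
      |∑ d, w d * sampled (threshold P j) ω d - (threshold P j : ℝ) / P * ∑ d, w d|).card : ℝ) *
        (η ^ 2 * ∑ d, w d) ≤ P ^ 2 * (2 * 2 ^ j) := by
  have hP0 : (0 : ℝ) < P := by exact_mod_cast hP.out.pos
  set t := threshold P j
  set W := ∑ d, w d
  set ρ : ℝ := (t : ℝ) / P with hρ
  have hρlow : 1 / (2 * 2 ^ j) ≤ ρ := le_threshold_ratio hj
  have hρ0 : 0 < ρ := lt_of_lt_of_le (one_div_pos.2 (by positivity)) hρlow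
  have h1 := card_mul_le_sum (fun ω : Seed P => (∑ d, w d * sampled t ω d - ρ * W) ^ 2)
    (fun ω => sq_nonneg _) ((η * (ρ * W)) ^ 2)
    (fun ω => η * (ρ * W) < |∑ d, w d * sampled t ω d - ρ * W|) (fun ω h => by
      rw [← sq_abs (∑ d, w d * sampled t ω d - ρ * W)]
      exact pow_le_pow_left₀ (by positivity) h.le 2)
  have h2 := h1.trans (sum_sq_deviation hn (threshold_le j) w)
  have h3 : ∑ d, w d ^ 2 ≤ W := Finset.sum_le_sum fun d _ => by nlinarith [hw0 d, hw1 d]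
  have ht : (t : ℝ) = ρ * P := by rw [hρ]; field_simp
  set N : ℝ := ((Finset.univ.filter fun ω : Seed P => η * (ρ * W) <
      |∑ d, w d * sampled t ω d - ρ * W|).card : ℝ)
  have hN : 0 ≤ N := Nat.cast_nonneg _
  have h4 : N * (η * (ρ * W)) ^ 2 ≤ P ^ 2 * ρ * W := by
    calc _ ≤ (P : ℝ) * t * ∑ d, w d ^ 2 := h2
      _ ≤ P * t * W := mul_le_mul_of_nonneg_left h3 (by positivity)
      _ = _ := by rw [ht]; ring
  have h5 : N * (η ^ 2 * W) * ρ ≤ P ^ 2 := by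
    have : N * (η ^ 2 * W) * ρ * (ρ * W) ≤ P ^ 2 * (ρ * W) := by nlinarith
    exact le_of_mul_le_mul_right this (mul_pos hρ0 hW)
  have h6 : N * (η ^ 2 * W) * (1 / (2 * 2 ^ j)) ≤ P ^ 2 :=
    (mul_le_mul_of_nonneg_left hρlow (mul_nonneg hN (mul_nonneg (sq_nonneg _) hW.le))).trans h5
  rwa [mul_one_div, div_le_iff₀ (by positivity)] at h6

end Hashing

/-! ### The sampled frequency vectors -/

section Levels

variable {n P : ℕ}

/-- The items with nonzero frequency. -/
def supp (x : Fin n → ℤ) : Finset (Fin n) := Finset.univ.filter fun d => x d ≠ 0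

theorem mem_supp {x : Fin n → ℤ} {d : Fin n} : d ∈ supp x ↔ x d ≠ 0 := by simp [supp]

/-- The frequency moment of a frequency vector. -/
noncomputable def moment (p : ℝ) (x : Fin n → ℤ) : ℝ := ∑ d ∈ supp x, |(x d : ℝ)| ^ p

theorem moment_freq (p : ℝ) (S : UpdateStream n) : moment p (freq S) = freqMoment p S := rfl

/-- The part of a frequency vector that is sampled on level `j`. -/
def restrict (ω : Seed P) (j : ℕ) (x : Fin n → ℤ) : Fin n → ℤ :=
  fun d => if hash ω d < threshold P j then x d else 0

/-- The least level on which at most `s` of the items with nonzero frequency are sampled. -/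
noncomputable def stopLevel (ω : Seed P) (s : ℕ) (x : Fin n → ℤ) : ℕ :=
  sInf {j | (supp (restrict ω j x)).card ≤ s}

/-- The estimate of the frequency moment from the part `y` sampled on level `j`. -/
noncomputable def estimate (P : ℕ) (p : ℝ) (j : ℕ) (y : Fin n → ℤ) : ℝ :=
  P / threshold P j * moment p y

theorem sum_supp_restrict (ω : Seed P) (j : ℕ) (x : Fin n → ℤ) (f : ℤ → ℝ) :
    ∑ d ∈ supp (restrict ω j x), f (restrict ω j x d) =
      ∑ d, (if x d ≠ 0 then f (x d) else 0) * sampled (threshold P j) ω d := by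
  rw [supp, Finset.sum_filter]
  refine Finset.sum_congr rfl fun d _ => ?_
  by_cases h : hash ω d < threshold P j <;> simp [restrict, sampled, h]

theorem card_supp_restrict (ω : Seed P) (j : ℕ) (x : Fin n → ℤ) :
    ((supp (restrict ω j x)).card : ℝ) =
      ∑ d, (if x d ≠ 0 then 1 else 0) * sampled (threshold P j) ω d := by
  rw [← sum_supp_restrict ω j x fun _ => 1]
  simp

theorem card_supp_eq_sum (x : Fin n → ℤ) :
    ((supp x).card : ℝ) = ∑ d, if x d ≠ 0 then (1 : ℝ) else 0 := by
  rw [supp, Finset.card_filter]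
  push_cast
  rfl

theorem moment_eq_sum (p : ℝ) (x : Fin n → ℤ) :
    moment p x = ∑ d, if x d ≠ 0 then |(x d : ℝ)| ^ p else 0 := by
  rw [moment, supp, Finset.sum_filter]

variable [hP : Fact P.Prime]

theorem restrict_zero (ω : Seed P) (x : Fin n → ℤ) : restrict ω 0 x = x := by
  funext d
  have : hash ω d < threshold P 0 := by simpa [threshold, hash] using ZMod.val_lt _
  simp [restrict, this]

theorem stopLevel_eq_zero (ω : Seed P) {s : ℕ} {x : Fin n → ℤ} (h : (supp x).card ≤ s) :
    stopLevel ω s x = 0 := by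
  rw [stopLevel, Nat.sInf_eq_zero]
  left
  simpa [restrict_zero] using h

theorem estimate_zero (p : ℝ) (x : Fin n → ℤ) : estimate P p 0 x = moment p x := by
  have : (P : ℝ) ≠ 0 := by exact_mod_cast hP.out.ne_zero
  simp [estimate, threshold, this]

theorem weight_le_one {p : ℝ} (hp : p < 0) (z : ℤ) :
    (if z ≠ 0 then |(z : ℝ)| ^ p else 0) ≤ 1 := by
  split_ifs with h
  · refine Real.rpow_le_one_of_one_le_of_nonpos ?_ hp.le
    exact_mod_cast Int.one_le_abs h
  · exact zero_le_one

theorem weight_nonneg (p : ℝ) (z : ℤ) : 0 ≤ (if z ≠ 0 then |(z : ℝ)| ^ p else 0) := by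
  split_ifs <;> positivity

theorem moment_nonneg (p : ℝ) (x : Fin n → ℤ) : 0 ≤ moment p x :=
  Finset.sum_nonneg fun _ _ => by positivity

/-! ### Failure probabilities of the sampling estimate -/

open Classical in
theorem card_estimate_bad_le (hn : n ≤ P) {j : ℕ} (hj : 2 ^ j ≤ P) {p ε : ℝ} (hp : p < 0)
    (hε : 0 < ε) (x : Fin n → ℤ) (hx : 0 < moment p x) :
    ((Finset.univ.filter fun ω : Seed P => ¬ estimate P p j (restrict ω j x) ∈
      Set.Icc ((1 - ε) * moment p x) ((1 + ε) * moment p x)).card : ℝ) * (ε ^ 2 * moment p x) ≤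
      P ^ 2 * (2 * 2 ^ j) := by
  have hP0 : (0 : ℝ) < P := by exact_mod_cast hP.out.pos
  have h := card_deviation_le (w := fun d => if x d ≠ 0 then |(x d : ℝ)| ^ p else 0) hn hj
    (fun d => weight_nonneg p _) (fun d => weight_le_one hp _) (by rwa [← moment_eq_sum]) hε
  simp only [← moment_eq_sum] at h
  refine le_trans (mul_le_mul_of_nonneg_right ?_ (by positivity)) h
  refine Nat.cast_le.2 (Finset.card_le_card fun ω => ?_)
  simp only [Finset.mem_filter, Finset.mem_univ, true_and]
  intro hω
  by_contra hcon
  push Not at hcon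
  apply hω
  have hρ : 0 < (threshold P j : ℝ) / P := lt_of_lt_of_le (by positivity) (le_threshold_ratio hj)
  have hmom : moment p (restrict ω j x) =
      ∑ d, (if x d ≠ 0 then |(x d : ℝ)| ^ p else 0) * sampled (threshold P j) ω d := by
    rw [moment, ← sum_supp_restrict ω j x fun z => |(z : ℝ)| ^ p]
  rw [← hmom, abs_le] at hcon
  have hest : estimate P p j (restrict ω j x) =
      moment p (restrict ω j x) / ((threshold P j : ℝ) / P) := by
    rw [estimate]; field_simp
  rw [hest, Set.mem_Icc, le_div_iff₀ hρ, div_le_iff₀ hρ]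
  constructor <;> nlinarith [hcon.1, hcon.2]

open Classical in
theorem card_crowded_le (j s : ℕ) (x : Fin n → ℤ) :
    ((Finset.univ.filter fun ω : Seed P => s < (supp (restrict ω j x)).card).card : ℝ) * s ≤
      P ^ 2 * ((supp x).card / 2 ^ j) := by
  have hP0 : (0 : ℝ) < P := by exact_mod_cast hP.out.pos
  refine (card_mul_le_sum (fun ω : Seed P => ((supp (restrict ω j x)).card : ℝ))
    (fun _ => Nat.cast_nonneg _) s _ (fun ω h => by exact_mod_cast h.le)).trans ?_
  simp_rw [card_supp_restrict]
  rw [Finset.sum_comm]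
  simp_rw [← Finset.mul_sum, sum_sampled (threshold_le (P := P) j)]
  rw [← Finset.sum_mul, ← card_supp_eq_sum]
  have h := threshold_ratio_le (P := P) j
  rw [div_le_iff₀ hP0] at h
  calc ((supp x).card : ℝ) * (P * threshold P j) ≤ (supp x).card * (P * (1 / 2 ^ j * P)) := by
        gcongr
    _ = _ := by ring

-- The least such j overshoots by less than a factor 2; `ha` covers j = 0.
omit hP in
theorem exists_first_level {a b : ℕ} (ha : a < b) (ha0 : 0 < a) :
    ∃ j, b ≤ a * 2 ^ j ∧ a * 2 ^ j < 2 * b := by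
  have hex : ∃ j, b ≤ a * 2 ^ j := by
    refine ⟨b, ?_⟩
    have := Nat.lt_two_pow_self (n := b)
    nlinarith
  classical
  refine ⟨Nat.find hex, Nat.find_spec hex, ?_⟩
  rcases hj : Nat.find hex with _ | j
  · simp; omega
  · have h1 : ¬ b ≤ a * 2 ^ j := Nat.find_min hex (by omega)
    rw [pow_succ, ← mul_assoc]
    omega

-- The stopping level depends on the seed, so the estimates must be good on all levels up to some j₀
-- simultaneously, and the process must have stopped by j₀. The failure bounds double from level to
-- level, hence their sum is comparable to the last one. Each of the two events fails for at most
-- 1/16 of the seeds.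
open Classical in
theorem card_bad_seeds_le (hn : n ≤ P) {p ε : ℝ} (hp : p < 0) (hε : 0 < ε) {s : ℕ} (hs : 32 ≤ s)
    (x : Fin n → ℤ)
    (hvar : s < (supp x).card → 2048 * ((supp x).card : ℝ) ≤ ε ^ 2 * moment p x * s) :
    8 * ((Finset.univ.filter fun ω : Seed P =>
      ¬ estimate P p (stopLevel ω s x) (restrict ω (stopLevel ω s x) x) ∈
        Set.Icc ((1 - ε) * moment p x) ((1 + ε) * moment p x)).card : ℝ) ≤ P ^ 2 := by
  have hF0 := moment_nonneg p x
  rcases le_or_gt (supp x).card s with hsmall | hbig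
  -- Level 0 keeps everything, so the estimate is exact; this includes the zero vector.
  · rw [Finset.filter_false_of_mem]
    · simp
    · intro ω _
      rw [not_not, stopLevel_eq_zero ω hsmall, restrict_zero, estimate_zero]
      constructor <;> nlinarith
  · specialize hvar hbig
    set r := (supp x).card with hr
    have hrn : r ≤ n := by simpa using Finset.card_le_univ (supp x)
    obtain ⟨j₀, hj1, hj2⟩ := exists_first_level (a := s) (b := 16 * r) (by omega) (by omega)
    -- Here s ≥ 32 matters: s · 2^j₀ < 32r ≤ 32P, so no threshold up to level j₀ is zero.
    have hj0P : 2 ^ j₀ ≤ P := by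
      have : 32 * 2 ^ j₀ ≤ s * 2 ^ j₀ := Nat.mul_le_mul_right _ hs
      omega
    have hsR : (0 : ℝ) < s := by exact_mod_cast (by omega : 0 < s)
    have hrR : (0 : ℝ) < r := by exact_mod_cast (by omega : 0 < r)
    have hFpos : 0 < moment p x := by
      rcases hF0.lt_or_eq with h | h
      · exact h
      · rw [← h] at hvar
        linarith
    set B : ℕ → Finset (Seed P) := fun j => Finset.univ.filter fun ω : Seed P =>
      ¬ estimate P p j (restrict ω j x) ∈
        Set.Icc ((1 - ε) * moment p x) ((1 + ε) * moment p x) with hB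
    set Q : Finset (Seed P) := Finset.univ.filter fun ω : Seed P =>
      s < (supp (restrict ω j₀ x)).card with hQ
    have hsub : (Finset.univ.filter fun ω : Seed P =>
        ¬ estimate P p (stopLevel ω s x) (restrict ω (stopLevel ω s x) x) ∈
        Set.Icc ((1 - ε) * moment p x) ((1 + ε) * moment p x)) ⊆
        Q ∪ (Finset.range (j₀ + 1)).biUnion B := by
      intro ω hω
      rw [Finset.mem_union]
      by_cases hq : ω ∈ Q
      · exact Or.inl hq
      · right
        rw [Finset.mem_biUnion]
        refine ⟨stopLevel ω s x, ?_, ?_⟩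
        · have : (supp (restrict ω j₀ x)).card ≤ s := by
            simpa [hQ] using hq
          exact Finset.mem_range.2 (Nat.lt_succ_of_le (Nat.sInf_le this))
        · simpa [hB] using hω
    have hQc : (Q.card : ℝ) * 16 ≤ P ^ 2 := by
      have h1 := card_crowded_le (P := P) j₀ s x
      rw [← hQ, ← hr] at h1
      have h2 : (r : ℝ) / 2 ^ j₀ ≤ s / 16 := by
        rw [div_le_div_iff₀ (by positivity) (by norm_num)]
        have : (16 * r : ℝ) ≤ s * 2 ^ j₀ := by exact_mod_cast hj1
        linarith
      have h3 : (Q.card : ℝ) * s ≤ P ^ 2 * (s / 16) :=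
        h1.trans (mul_le_mul_of_nonneg_left h2 (by positivity))
      have h4 : (Q.card * 16 : ℝ) * s ≤ P ^ 2 * s := by linarith
      exact le_of_mul_le_mul_right h4 hsR
    have hBc : ∀ j ∈ Finset.range (j₀ + 1), ((B j).card : ℝ) ≤
        P ^ 2 * 2 / (ε ^ 2 * moment p x) * 2 ^ j := by
      intro j hj
      have hjP : 2 ^ j ≤ P := (Nat.pow_le_pow_right (by norm_num)
        (Nat.lt_succ_iff.1 (Finset.mem_range.1 hj))).trans hj0P
      have := card_estimate_bad_le hn hjP hp hε x hFpos
      rw [div_mul_eq_mul_div, le_div_iff₀ (by positivity)]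
      linarith
    have hgeom : ∑ j ∈ Finset.range (j₀ + 1), (2 : ℝ) ^ j ≤ 2 * 2 ^ j₀ := by
      rw [geom_sum_eq (by norm_num), pow_succ]
      norm_num
      linarith
    have hBsum : 16 * (((Finset.range (j₀ + 1)).biUnion B).card : ℝ) ≤ P ^ 2 := by
      have h1 : (((Finset.range (j₀ + 1)).biUnion B).card : ℝ) ≤
          ∑ j ∈ Finset.range (j₀ + 1), ((B j).card : ℝ) := by
        exact_mod_cast Finset.card_biUnion_le
      have h2 := h1.trans (Finset.sum_le_sum hBc)
      rw [← Finset.mul_sum] at h2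
      have h3 := h2.trans (mul_le_mul_of_nonneg_left hgeom (by positivity))
      rw [div_mul_eq_mul_div, le_div_iff₀ (by positivity)] at h3
      have h5 : (s : ℝ) * 2 ^ j₀ < 2 * (16 * r) := by exact_mod_cast hj2
      set V : ℝ := (((Finset.range (j₀ + 1)).biUnion B).card : ℝ)
      have hV : 0 ≤ V := Nat.cast_nonneg _
      -- The constant 2048 = 16 · 128 originates here: the geometric sum contributes 4s · 2^j₀ <
      -- 128r.
      have hkey : (16 * V) * (128 * r) ≤ P ^ 2 * (128 * r) := by
        calc (16 * V) * (128 * r) = V * (2048 * r) := by ring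
          _ ≤ V * (ε ^ 2 * moment p x * s) := mul_le_mul_of_nonneg_left hvar hV
          _ = V * (ε ^ 2 * moment p x) * s := by ring
          _ ≤ P ^ 2 * 2 * (2 * 2 ^ j₀) * s := mul_le_mul_of_nonneg_right h3 hsR.le
          _ = P ^ 2 * (4 * (s * 2 ^ j₀)) := by ring
          _ ≤ P ^ 2 * (128 * r) := mul_le_mul_of_nonneg_left (by linarith) (by positivity)
      exact le_of_mul_le_mul_right hkey (by positivity)
    have hall : ((Finset.univ.filter fun ω : Seed P =>
        ¬ estimate P p (stopLevel ω s x) (restrict ω (stopLevel ω s x) x) ∈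
        Set.Icc ((1 - ε) * moment p x) ((1 + ε) * moment p x)).card : ℝ) ≤
        Q.card + ((Finset.range (j₀ + 1)).biUnion B).card := by
      exact_mod_cast (Finset.card_le_card hsub).trans (Finset.card_union_le _ _)
    linarith

-- At the chosen level the expected number of survivors lies between 2s and 8s. By Chebyshev the
-- true number is within half of its mean for all but 1/8 of the seeds, hence between s and 16s.
open Classical in
theorem card_no_middle_level_le (hn : n ≤ P) {s : ℕ} (hs : 32 ≤ s) (x : Fin n → ℤ)
    (hx : 16 * s < (supp x).card) :
    8 * ((Finset.univ.filter fun ω : Seed P => ¬ ∃ j, s < (supp (restrict ω j x)).card ∧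
      (supp (restrict ω j x)).card ≤ 16 * s).card : ℝ) ≤ P ^ 2 := by
  set r := (supp x).card with hr
  have hrn : r ≤ n := by simpa using Finset.card_le_univ (supp x)
  obtain ⟨j, hj1, hj2⟩ := exists_first_level (a := 8 * s) (b := r) (by omega) (by omega)
  have hjP : 2 ^ j ≤ P := by
    have : 32 * 2 ^ j ≤ s * 2 ^ j := Nat.mul_le_mul_right _ hs
    have h3 : 8 * s * 2 ^ j = 8 * (s * 2 ^ j) := by ring
    omega
  have hsR : (32 : ℝ) ≤ s := by exact_mod_cast hs
  have hrR : (0 : ℝ) < r := by exact_mod_cast (by omega : 0 < r)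
  have hj1R : (r : ℝ) ≤ 8 * s * 2 ^ j := by exact_mod_cast hj1
  have hj2R : 8 * s * 2 ^ j < 2 * (r : ℝ) := by exact_mod_cast hj2
  have h := card_deviation_le (P := P) (j := j) (w := fun d => if x d ≠ 0 then (1 : ℝ) else 0) hn hjP
    (fun d => by positivity) (fun d => by split_ifs <;> simp)
    (by rw [← card_supp_eq_sum]; exact hrR) (η := 1 / 2) (by norm_num)
  simp only [← card_supp_eq_sum, ← card_supp_restrict, ← hr] at h
  set V : ℝ := ((Finset.univ.filter fun ω : Seed P => ¬ ∃ j, s < (supp (restrict ω j x)).card ∧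
      (supp (restrict ω j x)).card ≤ 16 * s).card : ℝ) with hV
  have hle : V ≤ ((Finset.univ.filter fun ω : Seed P => 1 / 2 * ((threshold P j : ℝ) / P * r) <
      |((supp (restrict ω j x)).card : ℝ) - (threshold P j : ℝ) / P * r|).card : ℝ) := by
    refine Nat.cast_le.2 (Finset.card_le_card fun ω => ?_)
    simp only [Finset.mem_filter, Finset.mem_univ, true_and]
    intro hω
    by_contra hcon
    push Not at hcon
    apply hω
    refine ⟨j, ?_⟩
    rw [abs_le] at hcon
    have hlow : 2 * (s : ℝ) < (threshold P j : ℝ) / P * r := by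
      calc 2 * (s : ℝ) < 1 / (2 * 2 ^ j) * r := by
            rw [div_mul_eq_mul_div, lt_div_iff₀ (by positivity)]
            linarith
        _ ≤ _ := mul_le_mul_of_nonneg_right (le_threshold_ratio hjP) hrR.le
    have hup : (threshold P j : ℝ) / P * r ≤ 8 * s := by
      calc (threshold P j : ℝ) / P * r ≤ 1 / 2 ^ j * r :=
            mul_le_mul_of_nonneg_right (threshold_ratio_le j) hrR.le
        _ ≤ _ := by
            rw [div_mul_eq_mul_div, div_le_iff₀ (by positivity)]
            linarith
    constructor
    · have : (s : ℝ) < (supp (restrict ω j x)).card := by linarith [hcon.1]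
      exact_mod_cast this
    · have : ((supp (restrict ω j x)).card : ℝ) ≤ 16 * s := by linarith [hcon.2]
      exact_mod_cast this
  have hV0 : 0 ≤ V := Nat.cast_nonneg _
  have h2 : V * ((1 / 2) ^ 2 * r) ≤ P ^ 2 * (2 * 2 ^ j) :=
    (mul_le_mul_of_nonneg_right hle (by positivity)).trans h
  have h3 : (8 * V) * r ≤ P ^ 2 * r := by
    have h4 : 64 * (2 : ℝ) ^ j ≤ r := by
      have : 32 * (2 : ℝ) ^ j ≤ s * 2 ^ j := mul_le_mul_of_nonneg_right hsR (by positivity)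
      linarith
    calc (8 * V) * r = 32 * (V * ((1 / 2) ^ 2 * r)) := by ring
      _ ≤ 32 * (P ^ 2 * (2 * 2 ^ j)) := by linarith
      _ = P ^ 2 * (64 * 2 ^ j) := by ring
      _ ≤ P ^ 2 * r := mul_le_mul_of_nonneg_left h4 (by positivity)
  exact le_of_mul_le_mul_right h3 hrR

/-! ### Hölder's inequality and the required sample size -/

-- Hölder with exponents 1-p and (1-p)/(-p), applied to 1 = |x_d|^(p/(1-p)) · |x_d|^(-p/(1-p)) on
-- the support.
omit hP in
theorem card_supp_rpow_le {p : ℝ} (hp : p < 0) {m : ℕ} (x : Fin n → ℤ)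
    (hx : ∑ d, (x d).natAbs ≤ m) :
    ((supp x).card : ℝ) ^ (1 - p) ≤ moment p x * (m : ℝ) ^ (-p) := by
  have hq : 0 < 1 - p := by linarith
  have hconj : (1 - p).HolderConjugate ((1 - p) / (-p)) := by
    rw [Real.holderConjugate_iff]
    refine ⟨by linarith, ?_⟩
    field_simp
    ring
  have hpos : ∀ d ∈ supp x, 0 < |(x d : ℝ)| := by
    intro d hd
    rw [mem_supp] at hd
    positivity
  have h := Real.inner_le_Lp_mul_Lq_of_nonneg (supp x) hconj
    (f := fun d => |(x d : ℝ)| ^ (p / (1 - p))) (g := fun d => |(x d : ℝ)| ^ (-p / (1 - p)))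
    (fun d _ => by positivity) (fun d _ => by positivity)
  have h1 : ∑ d ∈ supp x, |(x d : ℝ)| ^ (p / (1 - p)) * |(x d : ℝ)| ^ (-p / (1 - p)) =
      (supp x).card := by
    rw [Finset.card_eq_sum_ones]
    push_cast
    refine Finset.sum_congr rfl fun d hd => ?_
    rw [← Real.rpow_add (hpos d hd)]
    rw [neg_div, add_neg_cancel, Real.rpow_zero]
  have h2 : ∑ d ∈ supp x, (|(x d : ℝ)| ^ (p / (1 - p))) ^ (1 - p) = moment p x := by
    refine Finset.sum_congr rfl fun d hd => ?_
    rw [← Real.rpow_mul (hpos d hd).le, div_mul_cancel₀ _ hq.ne']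
  have h3 : ∑ d ∈ supp x, (|(x d : ℝ)| ^ (-p / (1 - p))) ^ ((1 - p) / (-p)) ≤ m := by
    have : ∀ d ∈ supp x, (|(x d : ℝ)| ^ (-p / (1 - p))) ^ ((1 - p) / (-p)) = (x d).natAbs := by
      intro d hd
      rw [← Real.rpow_mul (hpos d hd).le, div_mul_div_cancel₀ hq.ne', div_self (by linarith),
        Real.rpow_one, Nat.cast_natAbs, Int.cast_abs]
    rw [Finset.sum_congr rfl this]
    have h4 : ∑ d ∈ supp x, (x d).natAbs ≤ m :=
      (Finset.sum_le_univ_sum_of_nonneg fun _ => Nat.zero_le _).trans hx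
    exact_mod_cast h4
  rw [h1, h2] at h
  have hF := moment_nonneg p x
  have h5 := Real.rpow_le_rpow (Nat.cast_nonneg _) h hq.le
  refine h5.trans ?_
  rw [Real.mul_rpow (by positivity) (by positivity), ← Real.rpow_mul hF, ← Real.rpow_mul
    (Finset.sum_nonneg fun _ _ => by positivity), one_div_mul_cancel hq.ne', Real.rpow_one,
    one_div_div, div_mul_cancel₀ _ hq.ne']
  gcongr
  linarith

-- By Hölder F/r ≥ r^(-p) m^p, and r ≥ s bounds this below by s^(-p) m^p. Hence ε²Fs/r ≥ ε² s^(1-p)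
-- m^p, which the choice of s makes at least 2048.
omit hP in
theorem sample_size_suffices {p ε : ℝ} (hp : p < 0) (hε : 0 < ε) {m s : ℕ} (hm : 0 < m)
    (hs : (2048 * (ε ^ (-2 : ℝ) * (m : ℝ) ^ (-p)) : ℝ) ≤ (s : ℝ) ^ (1 - p)) (x : Fin n → ℤ)
    (hx : ∑ d, (x d).natAbs ≤ m) (hsx : s < (supp x).card) :
    2048 * ((supp x).card : ℝ) ≤ ε ^ 2 * moment p x * s := by
  have hmR : (0 : ℝ) < m := by exact_mod_cast hm
  have hF := card_supp_rpow_le hp x hx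
  set r : ℝ := ((supp x).card : ℝ)
  set F := moment p x
  have hsr : (s : ℝ) ≤ r := Nat.cast_le.2 hsx.le
  have hs0 : (0 : ℝ) < s := by
    rcases Nat.eq_zero_or_pos s with rfl | h
    · rw [Nat.cast_zero, Real.zero_rpow (by linarith)] at hs
      have : 0 < (2048 * (ε ^ (-2 : ℝ) * (m : ℝ) ^ (-p)) : ℝ) := by positivity
      linarith
    · exact_mod_cast h
  have hr0 : 0 < r := hs0.trans_le hsr
  have h1 : (s : ℝ) ^ (1 - p) ≤ s * r ^ (-p) := by
    rw [sub_eq_add_neg, Real.rpow_add hs0, Real.rpow_one]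
    have := Real.rpow_le_rpow hs0.le hsr (by linarith : 0 ≤ -p)
    gcongr
  have h2 : r ^ (1 - p) = r * r ^ (-p) := by
    rw [sub_eq_add_neg, Real.rpow_add hr0, Real.rpow_one]
  have hε2 : ε ^ (-2 : ℝ) * ε ^ 2 = 1 := by
    rw [← Real.rpow_natCast ε 2, ← Real.rpow_add hε]
    norm_num
  have hmp : 0 < (m : ℝ) ^ (-p) := by positivity
  have h3 : (2048 * r) * (m : ℝ) ^ (-p) ≤ (ε ^ 2 * F * s) * (m : ℝ) ^ (-p) := by
    calc (2048 * r) * (m : ℝ) ^ (-p)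
        = r * ε ^ 2 * (2048 * (ε ^ (-2 : ℝ) * (m : ℝ) ^ (-p))) := by
          linear_combination (-(2048 * r * (m : ℝ) ^ (-p))) * hε2
      _ ≤ r * ε ^ 2 * (s * r ^ (-p)) :=
          mul_le_mul_of_nonneg_left (hs.trans h1) (by positivity)
      _ = ε ^ 2 * s * r ^ (1 - p) := by rw [h2]; ring
      _ ≤ ε ^ 2 * s * (F * (m : ℝ) ^ (-p)) := mul_le_mul_of_nonneg_left hF (by positivity)
      _ = _ := by ring
  exact le_of_mul_le_mul_right h3 hmp

end Levels

/-! ### The insertion-only algorithm -/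

/-! ### Nested levels and monotonicity of the stopping level -/

section Restrict

variable {n P : ℕ}

theorem threshold_antitone {i j : ℕ} (h : i ≤ j) : threshold P j ≤ threshold P i :=
  Nat.div_le_div_left (Nat.pow_le_pow_right (by norm_num) h) (by positivity)

theorem supp_restrict_subset_of_le (ω : Seed P) {i j : ℕ} (h : i ≤ j) (x : Fin n → ℤ) :
    supp (restrict ω j x) ⊆ supp (restrict ω i x) := by
  intro d hd
  rw [mem_supp, restrict] at hd ⊢
  split_ifs at hd with hj
  · rwa [if_pos (hj.trans_le (threshold_antitone h))]
  · exact absurd rfl hd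

theorem supp_restrict_subset_of_supp (ω : Seed P) (j : ℕ) {x y : Fin n → ℤ}
    (h : supp x ⊆ supp y) : supp (restrict ω j x) ⊆ supp (restrict ω j y) := by
  intro d hd
  rw [mem_supp, restrict] at hd ⊢
  split_ifs at hd with hj
  · rw [if_pos hj]
    exact mem_supp.1 (h (mem_supp.2 hd))
  · exact absurd rfl hd

theorem restrict_restrict_of_le (ω : Seed P) {i j : ℕ} (h : i ≤ j) (x : Fin n → ℤ) :
    restrict ω j (restrict ω i x) = restrict ω j x := by
  funext d
  simp only [restrict]
  split_ifs with h1 h2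
  · rfl
  · exact absurd (h1.trans_le (threshold_antitone h)) h2
  · rfl

theorem restrict_restrict_of_ge (ω : Seed P) {i j : ℕ} (h : j ≤ i) (x : Fin n → ℤ) :
    restrict ω j (restrict ω i x) = restrict ω i x := by
  funext d
  simp only [restrict]
  split_ifs with h1 h2 h2
  · rfl
  · rfl
  · exact absurd (h2.trans_le (threshold_antitone h)) h1
  · rfl

theorem restrict_add (ω : Seed P) (j : ℕ) (x y : Fin n → ℤ) :
    restrict ω j (x + y) = restrict ω j x + restrict ω j y := by
  funext d
  simp only [restrict, Pi.add_apply]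
  split_ifs <;> simp

theorem natAbs_restrict_le (ω : Seed P) (j : ℕ) (x : Fin n → ℤ) (d : Fin n) :
    (restrict ω j x d).natAbs ≤ (x d).natAbs := by
  rw [restrict]
  split_ifs <;> simp

theorem restrict_eq_zero (ω : Seed P) {j : ℕ} (hj : P < 2 ^ j) (x : Fin n → ℤ) :
    restrict ω j x = 0 := by
  funext d
  simp [restrict, threshold, Nat.div_eq_of_lt hj]

theorem stopLevel_le_of_card_le (ω : Seed P) {s j : ℕ} {x : Fin n → ℤ}
    (h : (supp (restrict ω j x)).card ≤ s) : stopLevel ω s x ≤ j := Nat.sInf_le h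

theorem supp_zero : supp (0 : Fin n → ℤ) = ∅ := by simp [supp]

theorem stopLevel_le_of_lt_two_pow (ω : Seed P) (s : ℕ) {j : ℕ} (hj : P < 2 ^ j) (x : Fin n → ℤ) :
    stopLevel ω s x ≤ j :=
  stopLevel_le_of_card_le ω (by simp [restrict_eq_zero ω hj, supp_zero])

theorem stopLevel_spec (ω : Seed P) (s : ℕ) (x : Fin n → ℤ) :
    (supp (restrict ω (stopLevel ω s x) x)).card ≤ s :=
  Nat.sInf_mem (s := {j | (supp (restrict ω j x)).card ≤ s})
    ⟨P, by simp [restrict_eq_zero ω Nat.lt_two_pow_self, supp_zero]⟩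

theorem stopLevel_mono (ω : Seed P) (s : ℕ) {x y : Fin n → ℤ} (h : supp x ⊆ supp y) :
    stopLevel ω s x ≤ stopLevel ω s y :=
  stopLevel_le_of_card_le ω ((Finset.card_le_card (supp_restrict_subset_of_supp ω _ h)).trans
    (stopLevel_spec ω s y))

/-- Levels are nested, so discarding what level j does not sample loses nothing if the stopping
level is at least j. The maximum is needed because below j the restricted vector looks too sparse.
-/
theorem max_stopLevel_restrict (ω : Seed P) (s j : ℕ) (x : Fin n → ℤ) (h : j ≤ stopLevel ω s x) :
    max j (stopLevel ω s (restrict ω j x)) = stopLevel ω s x := by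
  apply le_antisymm
  · refine max_le h (stopLevel_le_of_card_le ω ?_)
    rw [restrict_restrict_of_le ω h]
    exact stopLevel_spec ω s x
  · apply stopLevel_le_of_card_le
    have hspec := stopLevel_spec ω s (restrict ω j x)
    rcases le_total j (stopLevel ω s (restrict ω j x)) with h1 | h1
    · rwa [max_eq_right h1, ← restrict_restrict_of_le ω h1]
    · rwa [max_eq_left h1, ← restrict_restrict_of_ge ω h1]

theorem freq_concat_eq_add (S : UpdateStream n) (u : Fin n × ℤ) :
    freq (S ++ [u]) = freq S + Pi.single u.1 u.2 := by
  funext d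
  rw [freq_append, freq_singleton, Pi.add_apply, Pi.single_apply]
  simp only [eq_comm]

end Restrict

/-! ### Maintaining the sample under insertions -/

section Insertion

variable {n P : ℕ}

/-- One update of the insertion-only algorithm: the state consists of the seed, the current level,
and the frequencies of the items sampled on that level. -/
noncomputable def insertionUpdate (s : ℕ) (u : Fin n × ℤ) (σ : Seed P × ℕ × (Fin n → ℤ)) :
    Seed P × ℕ × (Fin n → ℤ) :=
  let y := restrict σ.1 σ.2.1 (σ.2.2 + Pi.single u.1 u.2)
  let j := max σ.2.1 (stopLevel σ.1 s y)
  (σ.1, j, restrict σ.1 j y)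

/-- The code of a state of the insertion-only algorithm. -/
noncomputable def insertionList (σ : Seed P × ℕ × (Fin n → ℤ)) : List ℤ :=
  [(σ.1.1.val : ℤ), (σ.1.2.val : ℤ), (σ.2.1 : ℤ)] ++
    (supp σ.2.2).toList.flatMap fun d : Fin n => [((d : ℕ) : ℤ), σ.2.2 d]

theorem flatMap_pair_inj (f f' : Fin n → ℤ) {l l' : List (Fin n)}
    (h : (l.flatMap fun d : Fin n => [((d : ℕ) : ℤ), f d]) = l'.flatMap fun d : Fin n => [((d : ℕ) : ℤ), f' d]) :
    l = l' ∧ ∀ d ∈ l, f d = f' d := by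
  induction l generalizing l' with
  | nil =>
    cases l' with
    | nil => simp
    | cons d' l' => simp at h
  | cons d l ih =>
    cases l' with
    | nil => simp at h
    | cons d' l' =>
      simp only [List.flatMap_cons, List.cons_append, List.nil_append, List.cons.injEq,
        Nat.cast_inj] at h
      obtain ⟨h1, h2, h3⟩ := h
      have hd : d = d' := Fin.ext h1
      subst hd
      obtain ⟨h4, h5⟩ := ih h3
      exact ⟨by rw [h4], by simpa using ⟨h2, h5⟩⟩

/-- Insertions only enlarge the support, so the stopping level never decreases and a discarded item
is never needed again. The state thus agrees with the one computed offline from the final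
frequencies. -/
theorem finalState_insertionUpdate [Fact P.Prime] (s : ℕ) (ω : Seed P) {S : UpdateStream n}
    (hS : ∀ u ∈ S, u.2 = 1) :
    finalState (insertionUpdate s) (ω, 0, 0) S =
      (ω, stopLevel ω s (freq S), restrict ω (stopLevel ω s (freq S)) (freq S)) := by
  induction S using List.reverseRecOn with
  | nil =>
    have h0 : freq ([] : UpdateStream n) = 0 := by funext d; simp
    have h1 : stopLevel ω s (0 : Fin n → ℤ) = 0 := stopLevel_eq_zero ω (by simp [supp_zero])
    rw [h0, h1, restrict_zero]
    rfl
  | append_singleton S u ih =>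
    rw [finalState_concat, ih fun v hv => hS v (by simp [hv]), freq_concat_eq_add]
    have hsupp : supp (freq S) ⊆ supp (freq S + Pi.single u.1 u.2) := by
      intro d hd
      rw [mem_supp] at hd ⊢
      rw [← freq_concat_eq_add]
      have := natAbs_freq_le_of_prefix hS d
      omega
    have hmono := stopLevel_mono ω s hsupp
    set j := stopLevel ω s (freq S)
    set x := freq S + Pi.single u.1 u.2 with hx
    have hy : restrict ω j (restrict ω j (freq S) + Pi.single u.1 u.2) = restrict ω j x := by
      rw [restrict_add, restrict_restrict_of_le ω le_rfl, ← restrict_add]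
    simp only [insertionUpdate]
    rw [hy, max_stopLevel_restrict ω s j x hmono, restrict_restrict_of_le ω hmono]

variable [hP : Fact P.Prime]

theorem insertionList_injective :
    Function.Injective (insertionList : Seed P × ℕ × (Fin n → ℤ) → List ℤ) := by
  rintro ⟨⟨a, b⟩, j, y⟩ ⟨⟨a', b'⟩, j', y'⟩ h
  simp only [insertionList, List.cons_append, List.nil_append, List.cons.injEq, Nat.cast_inj] at h
  obtain ⟨ha, hb, hj, hl⟩ := h
  obtain ⟨h1, h2⟩ := flatMap_pair_inj y y' hl
  have hs : supp y = supp y' := by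
    ext d
    rw [← Finset.mem_toList, h1, Finset.mem_toList]
  have hy : y = y' := by
    funext d
    by_cases hd : d ∈ supp y
    · exact h2 d (Finset.mem_toList.2 hd)
    · have hd' := hs ▸ hd
      rw [mem_supp, not_not] at hd hd'
      rw [hd, hd']
  rw [ZMod.val_injective P ha, ZMod.val_injective P hb, hj, hy]

theorem length_insertionList (σ : Seed P × ℕ × (Fin n → ℤ)) :
    (insertionList σ).length = 3 + 2 * (supp σ.2.2).card := by
  simp [insertionList, List.length_flatMap, Nat.mul_comm]
  omega

theorem val_le_pow {μ : ℕ} (hμ : 2 ≤ μ) (hPμ : P ≤ 2 * μ) (z : ZMod P) :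
    ((z.val : ℤ)).natAbs ≤ μ ^ 4 := by
  have h1 : z.val < P := z.val_lt
  have h2 : 2 * μ ≤ μ ^ 4 := by
    calc 2 * μ ≤ μ * μ := Nat.mul_le_mul_right _ hμ
      _ = μ ^ 2 := (sq μ).symm
      _ ≤ μ ^ 4 := Nat.pow_le_pow_right (by omega) (by norm_num)
  rw [Int.natAbs_natCast]
  omega

theorem insertion_upper_bound (hn2 : 2 ≤ n) (hn : n ≤ P) (hP2 : P ≤ 2 * n) {p ε : ℝ} (hp : p < 0)
    (hε : 0 < ε) {m s : ℕ} (hs32 : 32 ≤ s)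
    (hs : ∀ x : Fin n → ℤ, ∑ d, (x d).natAbs ≤ m → s < (supp x).card →
      2048 * ((supp x).card : ℝ) ≤ ε ^ 2 * moment p x * s) :
    ∃ A : Algorithm n, A.Approximates (insertionOnly n m) ε p ∧
      ∀ S ∈ insertionOnly n m, A.StorageAtMost S (96 * s * Real.log (maxMagnitude S)) := by
  have henc : Function.Injective fun σ : Seed P × ℕ × (Fin n → ℤ) => encodeList (insertionList σ) :=
    encodeList_injective.comp insertionList_injective
  refine ⟨stateAlgorithm (fun ω : Seed P => (ω, 0, 0)) (insertionUpdate s)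
    (fun σ => estimate P p σ.2.1 σ.2.2) (fun σ => encodeList (insertionList σ)), ?_, ?_⟩
  · refine stateAlgorithm_approximates henc fun S hS => ?_
    have h := card_bad_seeds_le hn hp hε hs32 (freq S) (hs _ hS.2)
    simp only [finalState_insertionUpdate s _ hS.1, ← moment_freq]
    have hcard : Fintype.card (Seed P) = P ^ 2 := by simp [Seed, ZMod.card, sq]
    rw [hcard]
    refine le_trans (Nat.mul_le_mul_right _ (by norm_num : 3 ≤ 8)) ?_
    exact_mod_cast h
  · intro S hS
    refine stateAlgorithm_storageAtMost henc fun k ω => ?_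
    have hSk := take_mem_insertionOnly hS k
    have hμn := le_maxMagnitude S
    have hμ2 : 2 ≤ maxMagnitude S := hn2.trans hμn
    have hfreq : ∀ d, (freq (S.take k) d).natAbs ≤ maxMagnitude S :=
      natAbs_freq_take_le_maxMagnitude S k
    rw [finalState_insertionUpdate s ω hSk.1]
    set μ := maxMagnitude S
    set x := freq (S.take k)
    have hμ4 : 2 * μ ≤ μ ^ 4 := by
      calc 2 * μ ≤ μ * μ := Nat.mul_le_mul_right _ hμ2
        _ = μ ^ 2 := (sq μ).symm
        _ ≤ μ ^ 4 := Nat.pow_le_pow_right (by omega) (by norm_num)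
    have hlen := length_encodeList_le hμ2
      (l := insertionList (ω, stopLevel ω s x, restrict ω (stopLevel ω s x) x)) (by
        intro z hz
        simp only [insertionList, List.cons_append, List.nil_append, List.mem_cons,
          List.mem_flatMap, Finset.mem_toList, List.not_mem_nil, or_false] at hz
        rcases hz with rfl | rfl | rfl | ⟨d, -, rfl | rfl⟩
        · exact val_le_pow hμ2 (by omega) _
        · exact val_le_pow hμ2 (by omega) _
        · have := stopLevel_le_of_lt_two_pow ω s (Nat.lt_two_pow_self (n := P)) x
          rw [Int.natAbs_natCast]
          omega
        · rw [Int.natAbs_natCast]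
          have := d.2
          omega
        · have h1 := natAbs_restrict_le ω (stopLevel ω s x) x d
          have h2 := hfreq d
          omega)
    refine hlen.trans ?_
    rw [length_insertionList]
    have hc : 3 + 2 * (supp (restrict ω (stopLevel ω s x) x)).card ≤ 3 * s := by
      have := stopLevel_spec ω s x
      omega
    have hcR : ((3 + 2 * (supp (restrict ω (stopLevel ω s x) x)).card : ℕ) : ℝ) ≤ 3 * s := by
      exact_mod_cast hc
    have hlog : 0 ≤ Real.log μ := Real.log_natCast_nonneg _
    calc _ ≤ (3 * s : ℝ) * (32 * Real.log μ) := mul_le_mul_of_nonneg_right hcR (by positivity)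
      _ = _ := by ring

end Insertion

/-! ### The turnstile algorithm -/

section Turnstile

variable {n : ℕ}

/-- The coefficient `d ^ i mod P` of a linear measurement. -/
def coeff (P i : ℕ) (d : Fin n) : ℤ := ((((d : ℕ) : ZMod P) ^ i).val : ℤ)

/-- The linear measurements of an integer vector with the coefficients `d ^ i mod P`. -/
def measure (P R : ℕ) (x : Fin n → ℤ) (i : Fin R) : ℤ := ∑ d, coeff P i d * x d

theorem measure_add (P R : ℕ) (x y : Fin n → ℤ) :
    measure P R (x + y) = measure P R x + measure P R y := by
  funext i
  simp [measure, mul_add, Finset.sum_add_distrib]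

/-- Restricted to the support, the first measurements form a square integer matrix that reduces mod
P to a transposed Vandermonde matrix with distinct nodes. Its determinant is nonzero mod P, hence
nonzero in ℤ. Reducing only the coefficients keeps them small while the measurements remain exact
integers. -/
theorem eq_zero_of_measure_eq_zero {P : ℕ} [hP : Fact P.Prime] (hn : n ≤ P) {R : ℕ}
    {u : Fin n → ℤ} (hu : (supp u).card ≤ R) (h : measure P R u = 0) : u = 0 := by
  set k := (supp u).card with hk
  let e : Fin k ≃ supp u := (supp u).equivFin.symm
  let M : Matrix (Fin k) (Fin k) ℤ := Matrix.of fun a b => coeff P a (e b : Fin n)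
  have hmap : M.map (Int.castRingHom (ZMod P)) =
      (Matrix.vandermonde fun b : Fin k => (((e b : Fin n) : ℕ) : ZMod P)).transpose := by
    ext a b
    simp [M, coeff, Matrix.vandermonde]
  have hdet : M.det ≠ 0 := by
    intro h0
    have h1 : (M.map (Int.castRingHom (ZMod P))).det = 0 := by
      rw [← RingHom.mapMatrix_apply, ← RingHom.map_det, h0, map_zero]
    rw [hmap, Matrix.det_transpose] at h1
    refine Matrix.det_vandermonde_ne_zero_iff.2 ?_ h1
    intro b c hbc
    by_contra hne
    refine natCast_sub_ne_zero hn (d := (e b : Fin n)) (e := (e c : Fin n)) ?_ (sub_eq_zero.2 hbc)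
    intro heq
    exact hne (e.injective (Subtype.ext heq))
  have hmul : M.mulVec (fun b => u (e b)) = 0 := by
    funext a
    have h1 := congrFun h ⟨a, a.2.trans_le hu⟩
    rw [measure, Pi.zero_apply] at h1
    have h2 : ∑ d ∈ supp u, coeff P a d * u d = ∑ d, coeff P a d * u d := by
      refine Finset.sum_subset (Finset.subset_univ _) fun d _ hd => ?_
      rw [mem_supp, not_not] at hd
      rw [hd, mul_zero]
    rw [Pi.zero_apply, ← h1, ← h2, ← Finset.sum_coe_sort]
    exact Equiv.sum_comp e (fun d : supp u => coeff P a (d : Fin n) * u d)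
  have hzero := Matrix.eq_zero_of_mulVec_eq_zero hdet hmul
  funext d
  by_contra hd
  have h1 := congrFun hzero (e.symm ⟨d, mem_supp.2 hd⟩)
  simp at h1
  exact hd h1

theorem card_supp_sub_le (x y : Fin n → ℤ) :
    (supp (x - y)).card ≤ (supp x).card + (supp y).card := by
  refine le_trans (Finset.card_le_card ?_) (Finset.card_union_le _ _)
  intro d hd
  rw [Finset.mem_union, mem_supp, mem_supp]
  rw [mem_supp, Pi.sub_apply] at hd
  by_contra hcon
  push Not at hcon
  exact hd (by rw [hcon.1, hcon.2, sub_zero])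

/-- The difference of two s-sparse vectors is 2s-sparse, whence 2s measurements. -/
theorem measure_inj {P : ℕ} [Fact P.Prime] (hn : n ≤ P) {s : ℕ} {x y : Fin n → ℤ}
    (hx : (supp x).card ≤ s) (hy : (supp y).card ≤ s)
    (h : measure P (2 * s) x = measure P (2 * s) y) : x = y := by
  refine sub_eq_zero.1 (eq_zero_of_measure_eq_zero hn (R := 2 * s) ?_ ?_)
  · have := card_supp_sub_le x y
    omega
  · have h1 := measure_add P (2 * s) (x - y) y
    rw [sub_add_cancel, h] at h1
    simpa using h1

open Classical in
/-- Recovers an `s`-sparse vector from its linear measurements. -/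
noncomputable def recover (P s : ℕ) (z : Fin (2 * s) → ℤ) : Fin n → ℤ :=
  if h : ∃ y : Fin n → ℤ, (supp y).card ≤ s ∧ measure P (2 * s) y = z then h.choose else 0

theorem recover_measure {P : ℕ} [Fact P.Prime] (hn : n ≤ P) {s : ℕ} {x : Fin n → ℤ}
    (hx : (supp x).card ≤ s) : recover P s (measure P (2 * s) x) = x := by
  have h : ∃ y : Fin n → ℤ, (supp y).card ≤ s ∧ measure P (2 * s) y = measure P (2 * s) x :=
    ⟨x, hx, rfl⟩
  rw [recover, dif_pos h]
  exact measure_inj hn h.choose_spec.1 hx h.choose_spec.2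

variable {P : ℕ}

/-- The linear sketch of a frequency vector: the measurements of the parts sampled on the levels up
to `J`. -/
def sketch (J R : ℕ) (ω : Seed P) (x : Fin n → ℤ) (ji : Fin (J + 1) × Fin R) : ℤ :=
  measure P R (restrict ω ji.1 x) ji.2

/-- One update of the turnstile algorithm. -/
def turnstileUpdate (J R : ℕ) (u : Fin n × ℤ) (σ : Seed P × (Fin (J + 1) × Fin R → ℤ)) :
    Seed P × (Fin (J + 1) × Fin R → ℤ) :=
  (σ.1, σ.2 + sketch J R σ.1 (Pi.single u.1 u.2))

/-- The level that the turnstile algorithm uses: the least one such that at most `s` items are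
recovered on it and on each higher level. -/
noncomputable def outputLevel (n P : ℕ) {J s' : ℕ} (s : ℕ)
    (z : Fin (J + 1) × Fin (2 * s') → ℤ) : ℕ :=
  sInf {j | ∀ i : Fin (J + 1), j ≤ i →
    (supp (recover P s' fun r => z (i, r) : Fin n → ℤ)).card ≤ s}

/-- The output of the turnstile algorithm. -/
noncomputable def turnstileOutput (n P : ℕ) {J s' : ℕ} (s : ℕ) (p : ℝ)
    (z : Fin (J + 1) × Fin (2 * s') → ℤ) : ℝ :=
  estimate P p (outputLevel n P s z)
    (recover P s' fun r => z (Fin.ofNat (J + 1) (outputLevel n P s z), r) : Fin n → ℤ)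

/-- The code of a state of the turnstile algorithm. -/
noncomputable def turnstileList {J R : ℕ} (σ : Seed P × (Fin (J + 1) × Fin R → ℤ)) : List ℤ :=
  (σ.1.1.val : ℤ) :: (σ.1.2.val : ℤ) :: Finset.univ.toList.map σ.2

theorem sketch_add (J R : ℕ) (ω : Seed P) (x y : Fin n → ℤ) :
    sketch J R ω (x + y) = sketch J R ω x + sketch J R ω y := by
  funext ji
  simp [sketch, restrict_add, measure_add]

theorem finalState_turnstileUpdate (J R : ℕ) (ω : Seed P) (S : UpdateStream n) :
    finalState (turnstileUpdate J R) (ω, 0) S = (ω, sketch J R ω (freq S)) := by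
  induction S using List.reverseRecOn with
  | nil =>
    have h0 : freq ([] : UpdateStream n) = 0 := by funext d; simp
    have h1 : sketch J R ω (0 : Fin n → ℤ) = 0 := by
      have := sketch_add J R ω (0 : Fin n → ℤ) 0
      simpa using this
    rw [h0, h1]
    rfl
  | append_singleton S u ih =>
    rw [finalState_concat, ih, freq_concat_eq_add, sketch_add]
    rfl

variable [hP : Fact P.Prime]

theorem turnstileList_injective {J R : ℕ} :
    Function.Injective (turnstileList : Seed P × (Fin (J + 1) × Fin R → ℤ) → List ℤ) := by
  rintro ⟨⟨a, b⟩, y⟩ ⟨⟨a', b'⟩, y'⟩ h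
  simp only [turnstileList, List.cons.injEq, Nat.cast_inj] at h
  obtain ⟨ha, hb, hl⟩ := h
  have hy : y = y' := by
    funext i
    exact List.map_inj_left.1 hl i (by simp)
  rw [ZMod.val_injective P ha, ZMod.val_injective P hb, hy]

/-- On a level with more than s' survivors `recover` may return anything, even a sparse vector. The
hypothesis `hx` supplies a witness level from which on recovery is exact; unless it is level 0, it
visibly has more than s items and so blocks every lower level. -/
theorem outputLevel_sketch (hn : n ≤ P) {J s s' : ℕ} (hJ : P < 2 ^ J) (hss : s ≤ s') (ω : Seed P)
    (x : Fin n → ℤ) (hx : ∃ j, (supp (restrict ω j x)).card ≤ s' ∧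
      (j = 0 ∨ s < (supp (restrict ω j x)).card)) :
    outputLevel n P s (sketch J (2 * s') ω x) = stopLevel ω s x := by
  have hrec : ∀ i : Fin (J + 1), (supp (restrict ω i x)).card ≤ s' →
      (recover P s' fun r => sketch J (2 * s') ω x (i, r)) = restrict ω i x :=
    fun i hi => recover_measure hn hi
  have hanti : ∀ {i j : ℕ}, i ≤ j →
      (supp (restrict ω j x)).card ≤ (supp (restrict ω i x)).card :=
    fun h => Finset.card_le_card (supp_restrict_subset_of_le ω h x)
  have hspec := stopLevel_spec ω s x
  have hkJ := stopLevel_le_of_lt_two_pow ω s hJ x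
  have hmem : ∀ i : Fin (J + 1), stopLevel ω s x ≤ i →
      (supp (recover P s' fun r => sketch J (2 * s') ω x (i, r) : Fin n → ℤ)).card ≤ s := by
    intro i hi
    have h1 := (hanti hi).trans hspec
    rwa [hrec i (h1.trans hss)]
  apply le_antisymm
  · exact Nat.sInf_le hmem
  · by_contra hlt
    push Not at hlt
    have hout : ∀ i : Fin (J + 1), outputLevel n P s (sketch J (2 * s') ω x) ≤ i →
        (supp (recover P s' fun r => sketch J (2 * s') ω x (i, r) : Fin n → ℤ)).card ≤ s :=
      Nat.sInf_mem (s := {j | ∀ i : Fin (J + 1), j ≤ i →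
        (supp (recover P s' fun r => sketch J (2 * s') ω x (i, r) : Fin n → ℤ)).card ≤ s})
        ⟨_, hmem⟩
    set o := outputLevel n P s (sketch J (2 * s') ω x)
    obtain ⟨j, hj1, hj2⟩ := hx
    have hjk : j < stopLevel ω s x := by
      rcases hj2 with rfl | hj2
      · omega
      · by_contra hle
        push Not at hle
        exact absurd ((hanti hle).trans hspec) (not_le.2 hj2)
    -- This level is at least j, hence decoded correctly, and at least o, hence has at most s items,
    -- against the minimality of the stopping level.
    have hmax : max o j < stopLevel ω s x := max_lt hlt hjk
    have h1 := hout ⟨max o j, by omega⟩ (le_max_left _ _)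
    rw [hrec ⟨max o j, by omega⟩ ((hanti (le_max_right o j)).trans hj1)] at h1
    exact absurd (stopLevel_le_of_card_le ω h1) (not_le.2 hmax)

theorem turnstileOutput_sketch (hn : n ≤ P) {J s s' : ℕ} (hJ : P < 2 ^ J) (hss : s ≤ s')
    (ω : Seed P) (p : ℝ) (x : Fin n → ℤ) (hx : ∃ j, (supp (restrict ω j x)).card ≤ s' ∧
      (j = 0 ∨ s < (supp (restrict ω j x)).card)) :
    turnstileOutput n P s p (sketch J (2 * s') ω x) =
      estimate P p (stopLevel ω s x) (restrict ω (stopLevel ω s x) x) := by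
  have hkJ := stopLevel_le_of_lt_two_pow ω s hJ x
  rw [turnstileOutput, outputLevel_sketch hn hJ hss ω x hx]
  have h1 : ((Fin.ofNat (J + 1) (stopLevel ω s x) : Fin (J + 1)) : ℕ) = stopLevel ω s x := by
    simp only [Fin.ofNat]
    -- `Fin.ofNat` reduces mod J+1, harmless because the stopping level is at most J.
    exact Nat.mod_eq_of_lt (by omega)
  congr 1
  have h2 : (fun r => sketch J (2 * s') ω x (Fin.ofNat (J + 1) (stopLevel ω s x), r)) =
      measure P (2 * s') (restrict ω (stopLevel ω s x) x) := by
    funext r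
    simp only [sketch, h1]
  rw [h2, recover_measure hn ((stopLevel_spec ω s x).trans hss)]

theorem natAbs_sketch_le (hn2 : 2 ≤ n) (hP2 : P ≤ 2 * n) {J R μ : ℕ} (hμ : n ≤ μ) (ω : Seed P)
    {x : Fin n → ℤ} (hx : ∀ d, (x d).natAbs ≤ μ) (ji : Fin (J + 1) × Fin R) :
    (sketch J R ω x ji).natAbs ≤ μ ^ 4 := by
  have h1 : (sketch J R ω x ji).natAbs ≤ ∑ _d : Fin n, P * μ := by
    rw [sketch, measure]
    refine (Int.natAbs_sum_le _ _).trans (Finset.sum_le_sum fun d _ => ?_)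
    rw [Int.natAbs_mul]
    refine Nat.mul_le_mul ?_ ((natAbs_restrict_le ω _ x d).trans (hx d))
    rw [coeff, Int.natAbs_natCast]
    exact (ZMod.val_lt _).le
  refine h1.trans ?_
  rw [Finset.sum_const, Finset.card_univ, Fintype.card_fin, smul_eq_mul]
  calc n * (P * μ) ≤ μ * ((μ * μ) * μ) := by
        refine Nat.mul_le_mul hμ (Nat.mul_le_mul_right _ (hP2.trans ?_))
        exact Nat.mul_le_mul (hn2.trans hμ) hμ
    _ = μ ^ 4 := by ring

theorem turnstile_upper_bound (hn2 : 2 ≤ n) (hn : n ≤ P) (hP2 : P ≤ 2 * n) {p ε : ℝ} (hp : p < 0)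
    (hε : 0 < ε) {m s : ℕ} (hs32 : 32 ≤ s)
    (hs : ∀ x : Fin n → ℤ, ∑ d, (x d).natAbs ≤ m → s < (supp x).card →
      2048 * ((supp x).card : ℝ) ≤ ε ^ 2 * moment p x * s) :
    ∃ A : Algorithm n, A.Approximates (turnstile n m) ε p ∧
      ∀ S ∈ turnstile n m, A.StorageAtMost S
        (9600 * s * (Real.log n ^ 2 * Real.log (maxMagnitude S))) := by
  set J := Nat.log 2 P + 1 with hJdef
  have hJ : P < 2 ^ J := Nat.lt_pow_succ_log_self (by norm_num) P
  have henc : Function.Injective fun σ : Seed P × (Fin (J + 1) × Fin (2 * (16 * s)) → ℤ) =>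
      encodeList (turnstileList σ) := encodeList_injective.comp turnstileList_injective
  refine ⟨stateAlgorithm (fun ω : Seed P => (ω, 0)) (turnstileUpdate J (2 * (16 * s)))
    (fun σ => turnstileOutput n P s p σ.2) (fun σ => encodeList (turnstileList σ)), ?_, ?_⟩
  · refine stateAlgorithm_approximates henc fun S hS => ?_
    classical
    simp only [finalState_turnstileUpdate, ← moment_freq]
    have hx : ∑ d, (freq S d).natAbs ≤ m := hS
    set x := freq S
    have h1 := card_bad_seeds_le hn hp hε hs32 x (hs x hx)
    have hcard : Fintype.card (Seed P) = P ^ 2 := by simp [Seed, ZMod.card, sq]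
    rw [hcard]
    -- Bad estimates and missing witness levels each exclude at most 1/8 of the seeds, and 1/4 <
    -- 1/3.
    set Q : Finset (Seed P) := Finset.univ.filter fun ω : Seed P =>
      ¬ estimate P p (stopLevel ω s x) (restrict ω (stopLevel ω s x) x) ∈
        Set.Icc ((1 - ε) * moment p x) ((1 + ε) * moment p x) with hQ
    have hgood : ∃ G : Finset (Seed P), 8 * (G.card : ℝ) ≤ P ^ 2 ∧ ∀ ω ∉ G,
        ∃ j, (supp (restrict ω j x)).card ≤ 16 * s ∧
          (j = 0 ∨ s < (supp (restrict ω j x)).card) := by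
      rcases le_or_gt (supp x).card (16 * s) with h | h
      · refine ⟨∅, by simp, fun ω _ => ⟨0, ?_, Or.inl rfl⟩⟩
        rwa [restrict_zero]
      · refine ⟨_, card_no_middle_level_le hn hs32 x h, fun ω hω => ?_⟩
        simp only [Finset.mem_filter, Finset.mem_univ, true_and, not_not] at hω
        obtain ⟨j, hj1, hj2⟩ := hω
        exact ⟨j, hj2, Or.inr hj1⟩
    obtain ⟨G, hG1, hG2⟩ := hgood
    have hsub : (Finset.univ.filter fun ω : Seed P =>
        ¬ turnstileOutput n P s p (sketch J (2 * (16 * s)) ω x) ∈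
          Set.Icc ((1 - ε) * moment p x) ((1 + ε) * moment p x)) ⊆ Q ∪ G := by
      intro ω hω
      rw [Finset.mem_union]
      by_cases hG : ω ∈ G
      · exact Or.inr hG
      · left
        rw [Finset.mem_filter] at hω ⊢
        rw [turnstileOutput_sketch hn hJ (by omega) ω p x (hG2 ω hG)] at hω
        exact hω
    have h2 := (Finset.card_le_card hsub).trans (Finset.card_union_le _ _)
    have h1N : 8 * Q.card ≤ P ^ 2 := by exact_mod_cast h1
    have hGN : 8 * G.card ≤ P ^ 2 := by exact_mod_cast hG1
    omega
  · intro S _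
    refine stateAlgorithm_storageAtMost henc fun k ω => ?_
    have hμn := le_maxMagnitude S
    have hμ2 : 2 ≤ maxMagnitude S := hn2.trans hμn
    have hfreq : ∀ d, (freq (S.take k) d).natAbs ≤ maxMagnitude S :=
      natAbs_freq_take_le_maxMagnitude S k
    rw [finalState_turnstileUpdate]
    set μ := maxMagnitude S
    set x := freq (S.take k)
    have hlen := length_encodeList_le hμ2
      (l := turnstileList (ω, sketch J (2 * (16 * s)) ω x)) (by
        intro z hz
        simp only [turnstileList, List.mem_cons, List.mem_map] at hz
        rcases hz with rfl | rfl | ⟨ji, -, rfl⟩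
        · exact val_le_pow hμ2 (by omega) _
        · exact val_le_pow hμ2 (by omega) _
        · exact natAbs_sketch_le hn2 hP2 hμn ω hfreq ji)
    refine hlen.trans ?_
    have hlistlen : (turnstileList (ω, sketch J (2 * (16 * s)) ω x)).length =
        (J + 1) * (2 * (16 * s)) + 2 := by
      simp [turnstileList]
    rw [hlistlen]
    have hlogμ : 0 ≤ Real.log μ := Real.log_natCast_nonneg _
    have hlog2 := Real.log_two_gt_d9
    have hlogn : Real.log 2 ≤ Real.log n := Real.log_le_log two_pos (by exact_mod_cast hn2)
    have hlogP : (Nat.log 2 P : ℝ) * Real.log 2 ≤ Real.log 2 + Real.log n := by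
      rw [← Real.log_pow, ← Real.log_mul (by norm_num) (by positivity)]
      refine Real.log_le_log (by positivity) ?_
      exact_mod_cast (Nat.pow_log_le_self 2 hP.out.ne_zero).trans hP2
    have hJR : ((J : ℝ) + 1) * Real.log 2 ≤ 4 * Real.log n := by
      rw [hJdef]
      push_cast
      linarith
    have hJ6 : (J : ℝ) + 1 ≤ 6 * Real.log n := by
      have : ((J : ℝ) + 1) * 0.69 ≤ 4 * Real.log n :=
        le_trans (mul_le_mul_of_nonneg_left (by linarith) (by positivity)) hJR
      linarith
    have hsR : (32 : ℝ) ≤ s := by exact_mod_cast hs32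
    have hsn : 32 * 0.69 ≤ (s : ℝ) * Real.log n :=
      mul_le_mul hsR (by linarith) (by norm_num) (by positivity)
    have hcount : (((J + 1) * (2 * (16 * s)) + 2 : ℕ) : ℝ) ≤ 200 * s * Real.log n := by
      push_cast
      have : ((J : ℝ) + 1) * s ≤ 6 * Real.log n * s := mul_le_mul_of_nonneg_right hJ6 (by positivity)
      linarith
    -- The algorithm itself needs only one factor log n; the second is slack, inserted using 1.5 log
    -- 2 > 1.
    have hsq : Real.log n ≤ 1.5 * Real.log n ^ 2 := by nlinarith
    calc _ ≤ (200 * s * Real.log n) * (32 * Real.log μ) :=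
          mul_le_mul_of_nonneg_right hcount (by positivity)
      _ = 6400 * s * (Real.log n * Real.log μ) := by ring
      _ ≤ 6400 * s * ((1.5 * Real.log n ^ 2) * Real.log μ) := by gcongr
      _ = _ := by ring

end Turnstile

/-! ### The sample size -/

theorem exists_sample_size {p ε : ℝ} (hp : p < 0) (hε : 0 < ε) (hε2 : ε ≤ 1 / 2) {m : ℕ}
    (hm : 0 < m) :
    ∃ s : ℕ, 32 ≤ s ∧ (s : ℝ) ≤ 2049 * (ε ^ (-(2 - p) / (1 - p)) * (m : ℝ) ^ (-p / (1 - p))) ∧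
      (2048 * (ε ^ (-2 : ℝ) * (m : ℝ) ^ (-p)) : ℝ) ≤ (s : ℝ) ^ (1 - p) := by
  have hq : 0 < 1 - p := by linarith
  have hm1 : (1 : ℝ) ≤ m := by exact_mod_cast hm
  have hm0 : (0 : ℝ) < m := by linarith
  set K : ℝ := ε ^ (-(2 - p) / (1 - p)) * (m : ℝ) ^ (-p / (1 - p)) with hK
  have hK1 : 1 ≤ K := by
    have h1 : 1 ≤ ε ^ (-(2 - p) / (1 - p)) :=
      Real.one_le_rpow_of_pos_of_le_one_of_nonpos hε (by linarith)
        (div_nonpos_of_nonpos_of_nonneg (by linarith) hq.le)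
    have h2 : 1 ≤ (m : ℝ) ^ (-p / (1 - p)) :=
      Real.one_le_rpow hm1 (div_nonneg (by linarith) hq.le)
    nlinarith
  have hKpow : K ^ (1 - p) = ε ^ (-(2 - p)) * (m : ℝ) ^ (-p) := by
    rw [hK, Real.mul_rpow (by positivity) (by positivity), ← Real.rpow_mul hε.le,
      ← Real.rpow_mul hm0.le, div_mul_cancel₀ _ hq.ne', div_mul_cancel₀ _ hq.ne']
  have hs : 2048 * K ≤ ⌈2048 * K⌉₊ := Nat.le_ceil _
  refine ⟨⌈2048 * K⌉₊, ?_, ?_, ?_⟩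
  · have : (32 : ℝ) ≤ ⌈2048 * K⌉₊ := by linarith
    exact_mod_cast this
  · have := (Nat.ceil_lt_add_one (by positivity : 0 ≤ 2048 * K)).le
    linarith
  · calc 2048 * (ε ^ (-2 : ℝ) * (m : ℝ) ^ (-p))
        ≤ (2048 : ℝ) ^ (1 - p) * (ε ^ (-(2 - p)) * (m : ℝ) ^ (-p)) := by
          have h1 : (2048 : ℝ) ≤ 2048 ^ (1 - p) := by
            conv_lhs => rw [← Real.rpow_one 2048]
            exact Real.rpow_le_rpow_of_exponent_le (by norm_num) (by linarith)
          -- The variance bound needs only ε^(-2); the claimed exponent is larger in absolute value,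
          -- which suffices as ε < 1.
          have h2 : ε ^ (-2 : ℝ) ≤ ε ^ (-(2 - p)) :=
            Real.rpow_le_rpow_of_exponent_ge hε (by linarith) (by linarith)
          gcongr
      _ = (2048 * K) ^ (1 - p) := by
          rw [Real.mul_rpow (by norm_num) (by positivity), hKpow]
      _ ≤ _ := Real.rpow_le_rpow (by positivity) hs hq.le

end Streaming

/-! ### Assembling the bounds -/

theorem mainTheorem3 :
    ∃ c : ℝ, 0 < c ∧ ∃ C : ℝ, 0 < C ∧
      ∀ (p ε : ℝ), p < 0 → 0 < ε → ε ≤ 1 / 2 →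
      ∀ (n m : ℕ), 1 ≤ n → n ≤ m →
        -- lower bound, insertion-only algorithms
        (∀ A : Streaming.Algorithm n,
          A.Approximates (Streaming.insertionOnly n m) ε p →
          ∀ b : ℝ, (∀ S ∈ Streaming.insertionOnly n m, A.StorageAtMost S b) →
            c * min (n : ℝ) (ε ^ (-1 / (1 - p)) * (m : ℝ) ^ (-p / (1 - p))) ≤ b) ∧
        -- lower bound, turnstile algorithms (already on the streams with `M ≤ m`)
        (∀ A : Streaming.Algorithm n,
          A.Approximates (Streaming.turnstile n m) ε p →
          ∀ b : ℝ, (∀ S ∈ Streaming.turnstile n m,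
              Streaming.maxMagnitude S ≤ m → A.StorageAtMost S b) →
            c * min (n : ℝ) (ε ^ (-1 / (1 - p)) * (m : ℝ) ^ (-p / (1 - p))) ≤ b) ∧
        -- upper bound, turnstile streams
        (2 ≤ n → ∃ A : Streaming.Algorithm n,
          A.Approximates (Streaming.turnstile n m) ε p ∧
          ∀ S ∈ Streaming.turnstile n m, A.StorageAtMost S
            (C * (ε ^ (-(2 - p) / (1 - p)) * (m : ℝ) ^ (-p / (1 - p)) *
              Real.log n ^ 2 * Real.log (Streaming.maxMagnitude S)))) ∧
        -- upper bound, insertion-only streams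
        (2 ≤ n → ∃ A : Streaming.Algorithm n,
          A.Approximates (Streaming.insertionOnly n m) ε p ∧
          ∀ S ∈ Streaming.insertionOnly n m, A.StorageAtMost S
            (C * (ε ^ (-(2 - p) / (1 - p)) * (m : ℝ) ^ (-p / (1 - p)) *
              Real.log (Streaming.maxMagnitude S)))) := by
  -- The upper constant exceeds 9600 · 2049, the turnstile storage factor times the sample size
  -- factor.
  refine ⟨1 / 1000, by norm_num, 20000000, by norm_num, ?_⟩
  intro p ε hp hε hε2 n m hn hnm
  obtain ⟨s, hs32, hsK, hs⟩ := Streaming.exists_sample_size hp hε hε2 (hn.trans hnm)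
  have hsuff : ∀ x : Fin n → ℤ, ∑ d, (x d).natAbs ≤ m → s < (Streaming.supp x).card →
      2048 * ((Streaming.supp x).card : ℝ) ≤ ε ^ 2 * Streaming.moment p x * s :=
    Streaming.sample_size_suffices hp hε (hn.trans hnm) hs
  -- Bertrand's postulate: items are distinct mod P, yet residues need only O(log n) bits.
  obtain ⟨P, hP, hnP, hP2⟩ := Nat.exists_prime_lt_and_le_two_mul n (by omega)
  have : Fact P.Prime := ⟨hP⟩
  set K : ℝ := ε ^ (-(2 - p) / (1 - p)) * (m : ℝ) ^ (-p / (1 - p))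
  have hK : 0 ≤ K := by positivity
  refine ⟨fun A hA b hb => Streaming.storage_lower_bound hn hnm hp hε hε2 A hA hb,
    fun A hA b hb => Streaming.storage_lower_bound hn hnm hp hε hε2 A
      (fun S hS => hA S (Streaming.insertionOnly_subset_turnstile m hS))
      (fun S hS => hb S (Streaming.insertionOnly_subset_turnstile m hS)
        (Streaming.maxMagnitude_le_of_insertionOnly hnm hS)), fun hn2 => ?_, fun hn2 => ?_⟩
  · obtain ⟨A, hA, hAs⟩ := Streaming.turnstile_upper_bound hn2 hnP.le hP2 hp hε hs32 hsuff
    refine ⟨A, hA, fun S hS k hk w hw => (hAs S hS k hk w hw).trans ?_⟩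
    have hlog : 0 ≤ Real.log n ^ 2 * Real.log (Streaming.maxMagnitude S) :=
      mul_nonneg (sq_nonneg _) (Real.log_natCast_nonneg _)
    calc 9600 * (s : ℝ) * (Real.log n ^ 2 * Real.log (Streaming.maxMagnitude S))
        ≤ (20000000 * K) * (Real.log n ^ 2 * Real.log (Streaming.maxMagnitude S)) :=
          mul_le_mul_of_nonneg_right (by linarith) hlog
      _ = _ := by ring
  · obtain ⟨A, hA, hAs⟩ := Streaming.insertion_upper_bound hn2 hnP.le hP2 hp hε hs32 hsuff
    refine ⟨A, hA, fun S hS k hk w hw => (hAs S hS k hk w hw).trans ?_⟩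
    have hlog : 0 ≤ Real.log (Streaming.maxMagnitude S) := Real.log_natCast_nonneg _
    calc 96 * (s : ℝ) * Real.log (Streaming.maxMagnitude S)
        ≤ (20000000 * K) * Real.log (Streaming.maxMagnitude S) :=
          mul_le_mul_of_nonneg_right (by linarith) hlog
      _ = _ := by ring
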